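/- Consider an uplink network in $\mathbb{R}^2$ with base stations and devices at the points of two independent homogeneous Poisson point processes with intensities $\lambda>0$ and $\mu>0$. Each device has $N$ finite queues of sizes $k_1,\dots,k_N$ (lower index means higher priority) and, in a time slot, transmits a packet of the first non-empty queue, or nothing if all its queues are empty. Under shared allocation each transmission uses a channel chosen uniformly among $C\ge 1$ channels. The queue lengths of the devices are independent with a common joint law $\mathbb{P}$ on $\prod_{i}\{0,\dots,k_i\}$, in particular they may have a stationary law of the preemptive priority queues with Bernoulli arrivals and delivery probabilities $p_1,\dots,p_N$. The typical device is at the origin and is served by the nearest base station $z_o$; received average powers are inverted to $\rho>0$, channel power gains are i.i.d. exponential with mean $1$, the path-loss exponent is $\eta>2$, the noise power is $\sigma^2\ge 0$ and the SINR threshold is $\theta>0$. The coverage probability of a packet of class $i$ of the typical device is $$p_i=\mathbb{P}\Big\{\frac{\rho h_o}{I_{\mathrm{out}}+I_{\mathrm{in}}+\sigma^2}>\theta\Big\},$$ where the interference is described by the following standard approximations. (i) Correlations between cells are ignored: the devices outside the cell have i.i.d. transmit powers $P_j$, with the law of $\rho\|z_o\|^{\eta}$, independent of the locations, and $I_{\mathrm{out}}=\sum_j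 P_jg_j\|y_j-z_o\|^{-\eta}$, the sum over the devices $y_j$ of the Poisson process of intensity $\mu$ that transmit on the channel of the typical device and satisfy $P_j\|y_j-z_o\|^{-\eta}<\rho$. (ii) Independently, the area of the cell of the typical device has the gamma distribution with shape $c=3.575$ and mean $1/\lambda$; given that it equals $a$, the number of further devices in the cell is Poisson with mean $\mu a$, and $I_{\mathrm{in}}$ is the sum of $\rho g$ over those of them, with gains $g$, that transmit on the channel of the typical device. Then $p_i$ is the same for every class $i\in\{1,\dots,N\}$, and $$p_i=\frac{\exp\Big\{-\frac{\sigma^2\theta}{\rho}-\frac{2\theta(1-\delta)\kappa}{\eta-2}\,{}_2F_1\big(1,1-\tfrac2\eta;2-\tfrac2\eta;-\theta\big)\Big\}}{\Big(1+\frac{\theta(1-\delta)\kappa}{(1+\theta)c}\Big)^{c}},$$ where $\delta=\mathbb{P}\{(0,\dots,0)\}$ is the probability that all $N$ queues of a device are empty, $\kappa=\mu/(\lambda C)$, and ${}_2F_1$ is the Gaussian hypergeometric function (the hypergeometric series, continued analytically to $(-\infty,-1]$). If $\eta=4$, this equals $$\frac{\exp\big\{-\frac{\sigma^2\theta}{\rho}-(1-\delta)\kappa\sqrt\theta\arctan\sqrt\theta\big\}}{\Big(1+\frac{\theta(1-\delta)\kappa}{(1+\theta)c}\Big)^{c}}.$$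 -/

import Mathlib

open MeasureTheory ProbabilityTheory
open scoped ENNReal NNReal

/-- The Euclidean plane. -/
abbrev Plane : Type := EuclideanSpace ℝ (Fin 2)

/-! ### Poisson point processes -/

/-- The number of points of the enumerated configuration `y` that lie in `B`. -/
noncomputable def pointCount (B : Set Plane) (y : ℕ → Plane) : ℝ≥0∞ :=
  ∑' j, B.indicator (fun _ => (1 : ℝ≥0∞)) (y j)

/-- `Q`, a law of enumerated configurations of points of the plane, is the law of a homogeneous
Poisson point process with intensity `m > 0` (in any enumeration of its points): the number of
points in a measurable set of finite area is Poisson with mean `m` times the area, and the numbers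
of points in disjoint sets are independent. -/
structure IsPoissonPointProcess (m : ℝ) (Q : Measure (ℕ → Plane)) : Prop where
  isProbabilityMeasure : IsProbabilityMeasure Q
  count_law : ∀ B : Set Plane, MeasurableSet B → volume B ≠ ∞ →
    Q.map (pointCount B) =
      (poissonMeasure (Real.toNNReal (m * volume.real B))).map (fun n : ℕ => (n : ℝ≥0∞))
  count_indep : ∀ (n : ℕ) (B : Fin n → Set Plane), (∀ l, MeasurableSet (B l)) →
    (∀ l, volume (B l) ≠ ∞) → Pairwise (fun l l' => Disjoint (B l) (B l')) →
    iIndepFun (fun l => pointCount (B l)) Q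

open Classical in
/-- The point of the configuration that is nearest to the origin (almost surely well defined for a
Poisson point process; the value `0` is used if there is none). -/
noncomputable def nearestPoint (ψ : ℕ → Plane) : Plane :=
  if h : ∃ j, ∀ l, ‖ψ j‖ ≤ ‖ψ l‖ then ψ (Nat.find h) else 0

/-! ### Priority queues and channel access -/

/-- Lengths of the `N` priority queues of a device, the `i`-th queue having size `k i`.
Lower indices mean higher priority. -/
abbrev QueueState {N : ℕ} (k : Fin N → ℕ) : Type := ∀ i, Fin (k i + 1)

/-- Class `l` is the one addressed by a device with queue lengths `q`: its queue is not empty and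
all queues of higher priority are empty. -/
def IsAddressed {N : ℕ} {k : Fin N → ℕ} (q : QueueState k) (l : Fin N) : Prop :=
  q l ≠ 0 ∧ ∀ m, m < l → q m = 0

/-- A channel access strategy: for each priority class, the law of the channel on which a packet
of this class is transmitted. -/
abbrev AccessStrategy (N C : ℕ) : Type := Fin N → PMF (Fin C)

/-- Shared allocation: whatever its class, a packet is sent on a channel that is chosen uniformly
among all the `C` channels. -/
noncomputable def sharedAccess (N C : ℕ) [NeZero C] : AccessStrategy N C :=
  fun _ => PMF.uniformOfFintype (Fin C)

/-- State of a device in a time slot: its queue lengths and, for each class, the channel that is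
selected if a packet of this class is transmitted. -/
abbrev DeviceState {N : ℕ} (k : Fin N → ℕ) (C : ℕ) : Type := QueueState k × (Fin N → Fin C)

/-- The law of the state of a device whose queue lengths have the joint law `π`. -/
noncomputable def deviceLaw {N C : ℕ} {k : Fin N → ℕ} (A : AccessStrategy N C)
    (π : PMF (QueueState k)) : Measure (DeviceState k C) :=
  π.toMeasure.prod (Measure.pi fun l => (A l).toMeasure)

/-- The device transmits on channel `ch`: some class is addressed, and `ch` is selected for it.
A device with empty queues does not transmit. -/
def TransmitsOn {N C : ℕ} {k : Fin N → ℕ} (s : DeviceState k C) (ch : Fin C) : Prop :=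
  ∃ l, IsAddressed s.1 l ∧ s.2 l = ch

/-! ### The preemptive priority queues of a device as a Markov chain -/

/-- Class `l` is transmitted without interruption when the arrivals of the slot are `a`: it is
addressed and no packet of higher priority arrives. -/
def IsServed {N : ℕ} {k : Fin N → ℕ} (q : QueueState k) (a : Fin N → Bool) (l : Fin N) : Prop :=
  IsAddressed q l ∧ ∀ m, m < l → a m = false

open Classical in
/-- Probability that a packet of class `l` departs (`some l`), or that none departs (`none`). -/
noncomputable def departureProb {N : ℕ} {k : Fin N → ℕ} (p : Fin N → ℝ) (q : QueueState k)
    (a : Fin N → Bool) : Option (Fin N) → ℝ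
  | none => 1 - ∑ l, if IsServed q a l then p l else 0
  | some l => if IsServed q a l then p l else 0

/-- Length of the `m`-th queue after the departure `d` and the arrivals `a`; packets that arrive
at a full queue are lost. -/
def nextLength {N : ℕ} {k : Fin N → ℕ} (q : QueueState k) (a : Fin N → Bool)
    (d : Option (Fin N)) (m : Fin N) : ℕ :=
  min (k m) ((q m : ℕ) - (if d = some m then 1 else 0) + (if a m then 1 else 0))

open Classical in
/-- One-slot transition probability of the queue lengths: in each class `m` a packet arrives with
probability `α m`, independently of the other classes, and a packet of class `l` that is transmitted
without interruption is delivered with probability `p l`. -/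
noncomputable def transitionProb {N : ℕ} {k : Fin N → ℕ} (α p : Fin N → ℝ)
    (q q' : QueueState k) : ℝ :=
  ∑ a : Fin N → Bool, (∏ m, if a m then α m else 1 - α m) *
    ∑ d : Option (Fin N), departureProb p q a d *
      (if ∀ m, (q' m : ℕ) = nextLength q a d m then 1 else 0)

/-- `π` is a steady state distribution of the queue lengths. -/
def IsStationaryQueueLaw {N : ℕ} {k : Fin N → ℕ} (α p : Fin N → ℝ) (π : PMF (QueueState k)) : Prop :=
  ∀ q', ∑ q, (π q).toReal * transitionProb α p q q' = (π q').toReal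

/-! ### The uplink network and its coverage probabilities -/

/-- Parameters of the network. -/
structure Network where
  /-- intensity of the base stations -/
  lam : ℝ
  /-- intensity of the devices -/
  mu : ℝ
  /-- path-loss exponent -/
  eta : ℝ
  /-- power control threshold -/
  rho : ℝ
  /-- noise power `σ²` -/
  noise : ℝ
  /-- decoding threshold of the SINR -/
  theta : ℝ
  lam_pos : 0 < lam
  mu_pos : 0 < mu
  two_lt_eta : 2 < eta
  rho_pos : 0 < rho
  noise_nonneg : 0 ≤ noise
  theta_pos : 0 < theta

namespace Network

/-- Law of the transmit power of a device under full channel inversion: `ρ r ^ η`, where `r` is the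
distance to the nearest base station. `Ψ` is the law of the base stations. -/
noncomputable def powerLaw (net : Network) (Ψ : Measure (ℕ → Plane)) : Measure ℝ :=
  Ψ.map fun ψ => net.rho * ‖nearestPoint ψ‖ ^ net.eta

/-- The shape parameter `c` of the gamma approximation of the normalised area of a Voronoi cell. -/
noncomputable def voronoiShape : ℝ := 3.575

/-- Law of the number of further devices in the cell of the typical device. The area of the cell has
the gamma distribution with shape `c` and mean `1 / λ`, and given that the area is `a`, the number
of devices is Poisson with mean `μ a`. -/
noncomputable def cellCountLaw (net : Network) : Measure ℕ :=
  (gammaMeasure voronoiShape (net.lam * voronoiShape)).bind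
    fun a => poissonMeasure (Real.toNNReal (net.mu * a))

/-- Everything random seen by the typical device at the origin in a time slot: its own channel power
gain and channel; the base stations; the locations of the devices; their transmit powers, channel
power gains and states; the number of further devices in the cell of the typical device, and their
channel power gains and states. -/
abbrev Sample {N : ℕ} (k : Fin N → ℕ) (C : ℕ) : Type :=
  ℝ × Fin C × (ℕ → Plane) × (ℕ → Plane) × (ℕ → ℝ × ℝ × DeviceState k C) ×
    ℕ × (ℕ → ℝ × DeviceState k C)

/-- The joint law when the typical device transmits a packet of class `i`. All items are independent:
the devices are located according to `Φ`, the base stations according to `Ψ`; the transmit powers of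
the interfering devices are i.i.d. (the correlations between the cells are ignored), the channel
power gains are i.i.d. exponential with mean one, and the states of the devices are i.i.d. -/
noncomputable def sampleLaw (net : Network) {N C : ℕ} {k : Fin N → ℕ} (Φ Ψ : Measure (ℕ → Plane))
    (A : AccessStrategy N C) (π : PMF (QueueState k)) (i : Fin N) : Measure (Sample k C) :=
  (expMeasure 1).prod <| (A i).toMeasure.prod <| Ψ.prod <| Φ.prod <|
    (Measure.infinitePi fun _ : ℕ => (net.powerLaw Ψ).prod ((expMeasure 1).prod (deviceLaw A π))).prod
      <| net.cellCountLaw.prod <|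
        Measure.infinitePi fun _ : ℕ => (expMeasure 1).prod (deviceLaw A π)

open Classical in
/-- Inter-cell interference at the base station `z` on channel `ch`. A device at `y` with transmit
power `P` and channel power gain `g` contributes `P g ‖y - z‖ ^ (-η)` if it transmits on `ch`; as it
inverts the path loss to a base station that is closer to it than `z`, only devices with
`P ‖y - z‖ ^ (-η) < ρ` are present. -/
noncomputable def interCell (net : Network) {N C : ℕ} {k : Fin N → ℕ} (ch : Fin C) (z : Plane)
    (y : ℕ → Plane) (marks : ℕ → ℝ × ℝ × DeviceState k C) : ℝ≥0∞ :=
  ∑' j, if TransmitsOn (marks j).2.2 ch ∧ (marks j).1 * ‖y j - z‖ ^ (-net.eta) < net.rho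
    then ENNReal.ofReal ((marks j).1 * (marks j).2.1 * ‖y j - z‖ ^ (-net.eta)) else 0

open Classical in
/-- Intra-cell interference on channel `ch` from `n` devices, which are received at the common base
station with average power `ρ`. -/
noncomputable def intraCell (net : Network) {N C : ℕ} {k : Fin N → ℕ} (ch : Fin C) (n : ℕ)
    (marks : ℕ → ℝ × DeviceState k C) : ℝ≥0∞ :=
  ∑ j ∈ Finset.range n, if TransmitsOn (marks j).2 ch
    then ENNReal.ofReal (net.rho * (marks j).1) else 0

/-- The SINR of the typical device, located at the origin and served by the nearest base station, at
which it is received with average power `ρ`. -/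
noncomputable def sinr (net : Network) {N C : ℕ} {k : Fin N → ℕ} : Sample k C → ℝ≥0∞
  | (h, ch, ψ, y, marks, n, cellMarks) =>
    ENNReal.ofReal (net.rho * h) /
      (net.interCell ch (nearestPoint ψ) y marks + net.intraCell ch n cellMarks
        + ENNReal.ofReal net.noise)

/-- The coverage probability of a packet of class `i`: the probability that its SINR exceeds `θ`. -/
noncomputable def coverageProb (net : Network) {N C : ℕ} {k : Fin N → ℕ} (Φ Ψ : Measure (ℕ → Plane))
    (A : AccessStrategy N C) (π : PMF (QueueState k)) (i : Fin N) : ℝ :=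
  (net.sampleLaw Φ Ψ A π i).real {s | ENNReal.ofReal net.theta < net.sinr s}

/-- The network is in steady state, with arrival probabilities `α`, coverage probabilities `p` and
law `π` of the queue lengths of a device: the queues evolve with delivery probabilities `p` and have
the stationary law `π`, and interference from devices in this law gives coverage probabilities `p`. -/
structure IsSteadyState (net : Network) {N C : ℕ} {k : Fin N → ℕ} (Φ Ψ : Measure (ℕ → Plane))
    (A : AccessStrategy N C) (α p : Fin N → ℝ) (π : PMF (QueueState k)) : Prop where
  arrival : ∀ i, α i ∈ Set.Icc (0 : ℝ) 1
  stationary : IsStationaryQueueLaw α p π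
  coverage : ∀ i, p i = net.coverageProb Φ Ψ A π i

end Network

/-! ### The Gaussian hypergeometric function -/

/-- `F` is the Gaussian hypergeometric function with parameters `a, b, u` on `(-∞, 1)`: it equals
the hypergeometric series on `(-1, 1)`, and it is real analytic. -/
def IsGaussHypergeometric (a b u : ℝ) (F : ℝ → ℝ) : Prop :=
  AnalyticOnNhd ℝ F (Set.Iio 1) ∧ ∀ z ∈ Set.Ioo (-1 : ℝ) 1,
    HasSum (fun n : ℕ => (ascPochhammer ℝ n).eval a * (ascPochhammer ℝ n).eval b * z ^ n /
      ((ascPochhammer ℝ n).eval u * (n.factorial : ℝ))) (F z)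

theorem IsGaussHypergeometric.eqOn {a b u : ℝ} {F G : ℝ → ℝ} (hF : IsGaussHypergeometric a b u F)
    (hG : IsGaussHypergeometric a b u G) : Set.EqOn F G (Set.Iio 1) := by
  refine hF.1.eqOn_of_preconnected_of_eventuallyEq hG.1 isPreconnected_Iio
    (show (0 : ℝ) ∈ Set.Iio 1 by norm_num) ?_
  filter_upwards [Ioo_mem_nhds (show (-1 : ℝ) < 0 by norm_num) one_pos] with z hz
  exact (hF.2 z hz).unique (hG.2 z hz)

open Classical in
/-- The Gaussian hypergeometric function `₂F₁(a, b, u; z)` for real `z < 1`: the sum of the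
hypergeometric series if `|z| < 1`, and its (unique) analytic continuation if `z ≤ -1`. -/
noncomputable def gaussHypergeometric (a b u z : ℝ) : ℝ :=
  if h : ∃ F : ℝ → ℝ, IsGaussHypergeometric a b u F then h.choose z else 0

/-!
The typical device has an exponential channel power gain, so given everything else it is covered
with probability `exp (-θ (I_out + I_in + σ²) / ρ)` (`expMeasure_ratio_gt`). The inter-cell and the
intra-cell interference have only the channel in common, and for every channel their Laplace
transforms at `θ / ρ` are the same; so the coverage probability is the product of these transforms
and of `exp (-θ σ² / ρ)` (`Network.coverageProb_sharedAccess`). The class `i` enters only through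
the law of the channel, which does not depend on `i` under shared allocation. A device transmits on
a given channel with probability `q = (1 - δ) / C` (`deviceLaw_transmitsOn`).

*Intra-cell interference.* Each further device in the cell contributes the factor
`1 - q θ / (1 + θ)`. The number of these devices is a gamma mixture of Poisson distributions, and
the Poisson generating function followed by the gamma Laplace transform gives the denominator of the
closed form.

*Inter-cell interference.* The Laplace functional of a Poisson process follows from the laws of the
counts for simple functions and then by monotone approximation
(`IsPoissonPointProcess.lintegral_expNeg_tsum`); independent marks are averaged out first
(`IsPoissonPointProcess.lintegral_expNeg_tsum_marked`). The exponent is an integral over the plane,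
which is translation invariant, so the position of the serving base station does not matter. The
transmit power is `ρ R ^ η`, with `R` the distance to the nearest base station, and by scaling the
integral is `R ^ 2` times its value for `R = 1`. The void probabilities give `E R ^ 2 = 1 / (λ π)`.

*The radial integral.* In polar coordinates, with `s = r ^ (2 - η)`, the remaining integral becomes
`∫₀¹ (1 + θ s ^ β)⁻¹ ds` with `β = η / (η - 2)`. Expanding the integrand about any `z₀ < 1` shows
that `z ↦ ∫₀¹ (1 - z s ^ β)⁻¹ ds` is analytic on `(-∞, 1)`, and about `0` the expansion is the
hypergeometric series. If `η = 4`, then `β = 2` and the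
integral is an arctangent.

All expectations are taken in `[0, ∞]`, with `expNeg t = e^{-t}` and `expNeg ∞ = 0`, so that no
integrability has to be checked and an infinite interference is covered.
-/

open Filter Topology

/-! ### The exponential function on `[0, ∞]` -/

/-- The function `t ↦ e^{-t}` on `[0, ∞]`, with `e^{-∞} = 0`. -/
noncomputable def expNeg (t : ℝ≥0∞) : ℝ≥0∞ := EReal.exp (-(t : EReal))

@[simp] lemma expNeg_zero : expNeg 0 = 1 := by simp [expNeg]

@[simp] lemma expNeg_top : expNeg ∞ = 0 := by simp [expNeg]

lemma expNeg_add (s t : ℝ≥0∞) : expNeg (s + t) = expNeg s * expNeg t := by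
  rw [expNeg, expNeg, expNeg, ← EReal.exp_add, EReal.coe_ennreal_add, EReal.neg_add]
  · rfl
  · exact Or.inl (EReal.coe_ennreal_ne_bot s)
  · exact Or.inr (EReal.coe_ennreal_ne_bot t)

lemma expNeg_ofReal {x : ℝ} (hx : 0 ≤ x) :
    expNeg (ENNReal.ofReal x) = ENNReal.ofReal (Real.exp (-x)) := by
  rw [expNeg, EReal.coe_ennreal_ofReal, max_eq_left hx, ← EReal.coe_neg, EReal.exp_coe]

lemma expNeg_le_one (t : ℝ≥0∞) : expNeg t ≤ 1 := by
  rw [expNeg, EReal.exp_le_one_iff, EReal.neg_le_zero]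
  exact EReal.coe_ennreal_nonneg t

lemma expNeg_antitone : Antitone expNeg := fun s t h => by
  rw [expNeg, expNeg, EReal.exp_le_exp_iff, EReal.neg_le_neg_iff]
  exact_mod_cast h

lemma continuous_expNeg : Continuous expNeg :=
  EReal.expHomeomorph.continuous.comp (continuous_neg.comp continuous_coe_ennreal_ereal)

@[fun_prop] lemma measurable_expNeg : Measurable expNeg := continuous_expNeg.measurable

lemma expNeg_sum {ι : Type*} (s : Finset ι) (f : ι → ℝ≥0∞) :
    expNeg (∑ i ∈ s, f i) = ∏ i ∈ s, expNeg (f i) := by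
  classical
  induction s using Finset.induction_on with
  | empty => simp
  | insert a s ha ih => rw [Finset.sum_insert ha, Finset.prod_insert ha, expNeg_add, ih]

lemma expNeg_nsmul (n : ℕ) (t : ℝ≥0∞) : expNeg (n * t) = expNeg t ^ n := by
  induction n with
  | zero => simp
  | succ n ih => rw [Nat.cast_succ, add_mul, one_mul, expNeg_add, ih, pow_succ]

/-- The inverse of `expNeg` on `[0, 1]`. -/
noncomputable def negLog (u : ℝ≥0∞) : ℝ≥0∞ := (-(ENNReal.log u)).toENNReal

lemma measurable_negLog : Measurable negLog := by
  unfold negLog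
  fun_prop

lemma expNeg_negLog {u : ℝ≥0∞} (hu : u ≤ 1) : expNeg (negLog u) = u := by
  have : 0 ≤ -(ENNReal.log u) := by
    rw [EReal.neg_nonneg]
    simpa using hu
  rw [expNeg, negLog, EReal.coe_toENNReal this, neg_neg, ENNReal.exp_log]

/-! ### Poisson, gamma and exponential distributions -/

/-- The probability generating function of the Poisson distribution. -/
lemma lintegral_pow_poissonMeasure (r : ℝ≥0) {a : ℝ≥0∞} (ha : a ≤ 1) :
    ∫⁻ n, a ^ n ∂(poissonMeasure r) = expNeg (r * (1 - a)) := by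
  have hat : a ≠ ∞ := (ha.trans_lt ENNReal.one_lt_top).ne
  lift a to ℝ≥0 using hat
  have ha' : (a : ℝ) ≤ 1 := by exact_mod_cast ha
  have h1 : (r : ℝ≥0∞) * (1 - a) = ENNReal.ofReal ((r : ℝ) * (1 - (a : ℝ))) := by
    rw [ENNReal.ofReal_mul r.coe_nonneg, ENNReal.ofReal_sub _ a.coe_nonneg]
    simp
  rw [h1, expNeg_ofReal (mul_nonneg r.coe_nonneg (by linarith)), poissonMeasure,
    lintegral_sum_measure]
  simp only [lintegral_smul_measure, lintegral_dirac, smul_eq_mul]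
  have h2 : ∀ n : ℕ, ENNReal.ofReal (Real.exp (-r) * r ^ n / n.factorial) * (a : ℝ≥0∞) ^ n =
      ENNReal.ofReal (Real.exp (-r) * ((r * a : ℝ) ^ n / n.factorial)) := by
    intro n
    have : (a : ℝ≥0∞) ^ n = ENNReal.ofReal ((a : ℝ) ^ n) := by
      rw [ENNReal.ofReal_pow a.coe_nonneg]; simp
    rw [this, ← ENNReal.ofReal_mul (by positivity)]
    congr 1
    rw [mul_pow]; ring
  have hs : HasSum (fun n : ℕ => Real.exp (-r) * ((r * a : ℝ) ^ n / n.factorial))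
      (Real.exp (-r) * Real.exp (r * a)) := by
    rw [Real.exp_eq_exp_ℝ]
    exact (NormedSpace.expSeries_div_hasSum_exp (r * a : ℝ)).mul_left _
  simp_rw [h2]
  rw [← ENNReal.ofReal_tsum_of_nonneg (fun n => by positivity) hs.summable, hs.tsum_eq,
    ← Real.exp_add]
  congr 2
  ring

/-- The Laplace transform of the gamma distribution. -/
lemma lintegral_expNeg_gammaMeasure {a r t : ℝ} (ha : 0 < a) (hr : 0 < r) (ht : 0 ≤ t) :
    ∫⁻ x, expNeg (ENNReal.ofReal (t * x)) ∂(gammaMeasure a r) =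
      ENNReal.ofReal ((r / (r + t)) ^ a) := by
  have hrt : 0 < r + t := by linarith
  have hm : Measurable (gammaPDF a r) := (measurable_gammaPDFReal a r).ennreal_ofReal
  rw [gammaMeasure, lintegral_withDensity_eq_lintegral_mul _ hm (by fun_prop)]
  have h : ∀ x, (gammaPDF a r * fun x => expNeg (ENNReal.ofReal (t * x))) x =
      ENNReal.ofReal ((r / (r + t)) ^ a) * gammaPDF a (r + t) x := by
    intro x
    rw [Pi.mul_apply]
    rcases lt_or_ge x 0 with hx | hx
    · rw [gammaPDF_of_neg hx, gammaPDF_of_neg hx, zero_mul, mul_zero]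
    · rw [gammaPDF_of_nonneg hx, gammaPDF_of_nonneg hx, expNeg_ofReal (by positivity),
        ← ENNReal.ofReal_mul (by positivity), ← ENNReal.ofReal_mul (by positivity)]
      congr 1
      rw [Real.div_rpow hr.le hrt.le, show -((r + t) * x) = -(r * x) + -(t * x) by ring,
        Real.exp_add]
      have : (r + t) ^ a ≠ 0 := by positivity
      field_simp
  simp_rw [h]
  have hm' : Measurable (gammaPDF a (r + t)) := (measurable_gammaPDFReal a _).ennreal_ofReal
  rw [lintegral_const_mul _ hm',
    lintegral_gammaPDF_eq_one ha hrt, mul_one]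

lemma lintegral_expNeg_expMeasure {t : ℝ} (ht : 0 ≤ t) :
    ∫⁻ x, expNeg (ENNReal.ofReal (t * x)) ∂(expMeasure 1) = ENNReal.ofReal (1 / (1 + t)) := by
  rw [expMeasure, lintegral_expNeg_gammaMeasure one_pos one_pos ht, Real.rpow_one]

lemma expMeasure_Ioi {x : ℝ} (hx : 0 ≤ x) :
    expMeasure 1 (Set.Ioi x) = ENNReal.ofReal (Real.exp (-x)) := by
  have := isProbabilityMeasure_expMeasure one_pos
  have h := cdf_expMeasure_eq one_pos x
  rw [cdf_eq_real, if_pos hx, one_mul] at h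
  rw [← Set.compl_Iic, ← ofReal_measureReal (s := (Set.Iic x)ᶜ),
    probReal_compl_eq_one_sub measurableSet_Iic, h]
  congr 1
  ring

/-- For Rayleigh fading the probability that the signal-to-interference ratio exceeds `θ` is the
exponential of the interference. The values `0` and `∞` of the interference `X` are covered. -/
lemma expMeasure_ratio_gt {θ ρ : ℝ} (hθ : 0 < θ) (hρ : 0 < ρ) (X : ℝ≥0∞) :
    expMeasure 1 {h | ENNReal.ofReal θ < ENNReal.ofReal (ρ * h) / X} =
      expNeg (ENNReal.ofReal (θ / ρ) * X) := by
  have hpos : ENNReal.ofReal θ ≠ 0 := by simpa using hθ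
  have hpos' : ENNReal.ofReal (θ / ρ) ≠ 0 := by
    simp only [ne_eq, ENNReal.ofReal_eq_zero, not_le]
    positivity
  induction X with
  | top => simp [ENNReal.mul_top hpos']
  | coe x =>
    have key : {h : ℝ | ENNReal.ofReal θ < ENNReal.ofReal (ρ * h) / (x : ℝ≥0∞)} =
        Set.Ioi (θ / ρ * x) := by
      ext h
      rw [Set.mem_ofPred_eq, Set.mem_Ioi,
        ENNReal.lt_div_iff_mul_lt (Or.inr ENNReal.ofReal_ne_top) (Or.inl ENNReal.coe_ne_top)]
      · rw [← ENNReal.ofReal_coe_nnreal, ← ENNReal.ofReal_mul hθ.le,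
          ENNReal.ofReal_lt_ofReal_iff']
        constructor
        · rintro ⟨h1, -⟩
          rw [div_mul_eq_mul_div, div_lt_iff₀ hρ]
          linarith
        · intro h1
          have h0 : 0 < h := lt_of_le_of_lt (by positivity) h1
          rw [div_mul_eq_mul_div, div_lt_iff₀ hρ] at h1
          exact ⟨by linarith, by positivity⟩
    rw [key, expMeasure_Ioi (by positivity), ← ENNReal.ofReal_coe_nnreal,
      ← ENNReal.ofReal_mul (by positivity), expNeg_ofReal (by positivity)]

/-! ### Laplace functionals of Poisson point processes -/

lemma measurable_pointCount {B : Set Plane} (hB : MeasurableSet B) : Measurable (pointCount B) := by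
  unfold pointCount
  exact Measurable.tsum fun j =>
    (measurable_const.indicator hB).comp (measurable_pi_apply j)

/-- Monotone convergence for sums over the points of a configuration. -/
lemma tendsto_tsum_of_monotone {f : ℕ → ℕ → ℝ≥0∞} {g : ℕ → ℝ≥0∞}
    (hf : ∀ j, Monotone fun n => f n j) (hg : ∀ j, Tendsto (fun n => f n j) atTop (𝓝 (g j))) :
    Tendsto (fun n => ∑' j, f n j) atTop (𝓝 (∑' j, g j)) := by
  simp_rw [← lintegral_count]
  exact lintegral_tendsto_of_tendsto_of_monotone (fun n => (Measurable.of_discrete).aemeasurable)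
    (ae_of_all _ hf) (ae_of_all _ hg)

namespace IsPoissonPointProcess

variable {m : ℝ} {Φ : Measure (ℕ → Plane)}

lemma iIndepFun_pointCount (hΦ : IsPoissonPointProcess m Φ) {ι : Type*} [Fintype ι]
    (B : ι → Set Plane) (hB : ∀ i, MeasurableSet (B i)) (hvol : ∀ i, volume (B i) ≠ ∞)
    (hdisj : Pairwise fun i j => Disjoint (B i) (B j)) :
    iIndepFun (fun i => pointCount (B i)) Φ := by
  let e := Fintype.equivFin ι
  have h := hΦ.count_indep (Fintype.card ι) (fun l => B (e.symm l)) (fun l => hB _)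
    (fun l => hvol _)
    (fun l l' hl => hdisj (e.symm.injective.ne hl))
  simpa using h.precomp e.injective

lemma lintegral_expNeg_pointCount (hm : 0 ≤ m) (hΦ : IsPoissonPointProcess m Φ) {B : Set Plane}
    (hB : MeasurableSet B) (hvol : volume B ≠ ∞) (c : ℝ≥0∞) :
    ∫⁻ y, expNeg (c * pointCount B y) ∂Φ =
      expNeg (ENNReal.ofReal m * (volume B * (1 - expNeg c))) := by
  have h : ∫⁻ y, expNeg (c * pointCount B y) ∂Φ = ∫⁻ t, expNeg (c * t) ∂(Φ.map (pointCount B)) :=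
    (lintegral_map (f := fun t => expNeg (c * t)) (by fun_prop) (measurable_pointCount hB)).symm
  rw [h, hΦ.count_law B hB hvol, lintegral_map (by fun_prop) .of_discrete]
  simp_rw [mul_comm c, expNeg_nsmul]
  rw [lintegral_pow_poissonMeasure _ (expNeg_le_one c), ← mul_assoc]
  congr 2
  change ENNReal.ofReal _ = _
  rw [ENNReal.ofReal_mul hm, ofReal_measureReal hvol]

lemma lintegral_expNeg_sum_pointCount (hm : 0 ≤ m) (hΦ : IsPoissonPointProcess m Φ) {ι : Type*}
    [Fintype ι] (B : ι → Set Plane) (hB : ∀ i, MeasurableSet (B i)) (hvol : ∀ i, volume (B i) ≠ ∞)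
    (hdisj : Pairwise fun i j => Disjoint (B i) (B j)) (c : ι → ℝ≥0∞) :
    ∫⁻ y, expNeg (∑ i, c i * pointCount (B i) y) ∂Φ =
      expNeg (ENNReal.ofReal m * ∑ i, (1 - expNeg (c i)) * volume (B i)) := by
  simp_rw [expNeg_sum]
  have hind := (hΦ.iIndepFun_pointCount B hB hvol hdisj).comp
    (fun i t => expNeg (c i * t)) (fun i => by fun_prop)
  have h := lintegral_prod_eq_prod_lintegral_of_indepFun Finset.univ _ hind
    (fun i => by
      have := measurable_pointCount (hB i)
      fun_prop)
  simp only [Function.comp_apply] at h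
  rw [h, Finset.mul_sum, expNeg_sum]
  refine Finset.prod_congr rfl fun i _ => ?_
  rw [hΦ.lintegral_expNeg_pointCount hm (hB i) (hvol i), mul_comm (volume (B i))]

/-- The Laplace functional of a Poisson point process for simple functions. -/
lemma lintegral_expNeg_tsum_simpleFunc (hm : 0 ≤ m) (hΦ : IsPoissonPointProcess m Φ)
    (g : SimpleFunc Plane ℝ≥0∞) (hg : ∀ c, c ≠ 0 → volume (g ⁻¹' {c}) ≠ ∞) :
    ∫⁻ y, expNeg (∑' j, g (y j)) ∂Φ =
      expNeg (ENNReal.ofReal m * ∫⁻ x, (1 - expNeg (g x))) := by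
  classical
  let s := g.range.filter (· ≠ 0)
  have hs : ∀ c : s, (c : ℝ≥0∞) ≠ 0 := fun c => (Finset.mem_filter.1 c.2).2
  have key := hΦ.lintegral_expNeg_sum_pointCount hm (fun c : s => g ⁻¹' {(c : ℝ≥0∞)})
    (fun c => g.measurableSet_fiber _) (fun c => hg _ (hs c))
    (fun c d hcd => Disjoint.preimage _ (by simpa using Subtype.coe_injective.ne hcd))
    (fun c => (c : ℝ≥0∞))
  have hpt : ∀ (φ : ℝ≥0∞ → ℝ≥0∞), φ 0 = 0 → ∀ x, φ (g x) =
      ∑ c : s, φ c * (g ⁻¹' {(c : ℝ≥0∞)}).indicator (fun _ => 1) x := by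
    intro φ hφ x
    rw [Finset.sum_coe_sort s (fun c => φ c * (g ⁻¹' {c}).indicator (fun _ => 1) x)]
    by_cases hx : g x = 0
    · rw [hx, hφ, Finset.sum_eq_zero]
      intro c hc
      have : c ≠ 0 := (Finset.mem_filter.1 hc).2
      rw [Set.indicator_of_notMem, mul_zero]
      simp [hx, this.symm]
    · rw [Finset.sum_eq_single (g x)]
      · simp
      · intro c _ hc
        rw [Set.indicator_of_notMem, mul_zero]
        simp [hc.symm]
      · intro h
        exact absurd (Finset.mem_filter.2 ⟨g.mem_range_self x, hx⟩) h
  have h1 : ∀ y : ℕ → Plane, ∑' j, g (y j) =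
      ∑ c : s, (c : ℝ≥0∞) * pointCount (g ⁻¹' {(c : ℝ≥0∞)}) y := by
    intro y
    simp_rw [pointCount, ← ENNReal.tsum_mul_left]
    rw [← Summable.tsum_finsetSum (fun _ _ => ENNReal.summable)]
    exact tsum_congr fun j => hpt id rfl (y j)
  have h2 : ∫⁻ x, (1 - expNeg (g x)) =
      ∑ c : s, (1 - expNeg c) * volume (g ⁻¹' {(c : ℝ≥0∞)}) := by
    rw [lintegral_congr (hpt (fun t => 1 - expNeg t) (by simp)), lintegral_finsetSum]
    · refine Finset.sum_congr rfl fun c _ => ?_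
      rw [lintegral_const_mul _ (measurable_const.indicator (g.measurableSet_fiber _)),
        lintegral_indicator (g.measurableSet_fiber _)]
      simp
    · exact fun c _ => (measurable_const.indicator (g.measurableSet_fiber _)).const_mul _
  rw [h2, ← key]
  simp_rw [h1]

/-- The Laplace functional of a Poisson point process. -/
lemma lintegral_expNeg_tsum (hm : 0 ≤ m) (hΦ : IsPoissonPointProcess m Φ)
    {f : Plane → ℝ≥0∞} (hf : Measurable f) :
    ∫⁻ y, expNeg (∑' j, f (y j)) ∂Φ =
      expNeg (ENNReal.ofReal m * ∫⁻ x, (1 - expNeg (f x))) := by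
  have := hΦ.isProbabilityMeasure
  let B : ℕ → Set Plane := fun n => Metric.closedBall 0 n
  have hB : ∀ n, MeasurableSet (B n) := fun n => measurableSet_closedBall
  -- the approximating simple functions are supported in balls, so their fibres have finite area
  let g : ℕ → SimpleFunc Plane ℝ≥0∞ := fun n => (SimpleFunc.eapprox f n).restrict (B n)
  have hgi : ∀ n x, g n x = (B n).indicator (SimpleFunc.eapprox f n) x := fun n x => by
    rw [SimpleFunc.restrict_apply _ (hB n)]
  have hmono : ∀ x, Monotone fun n => g n x := by
    intro x a b hab
    simp only [hgi]
    refine (Set.indicator_le_indicator_of_subset (Metric.closedBall_subset_closedBall ?_)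
      (fun _ => zero_le) x).trans (Set.indicator_le_indicator ?_)
    · exact_mod_cast hab
    · exact SimpleFunc.monotone_eapprox f hab x
  have htend : ∀ x, Tendsto (fun n => g n x) atTop (𝓝 (f x)) := by
    intro x
    refine (SimpleFunc.tendsto_eapprox hf x).congr' ?_
    filter_upwards [eventually_ge_atTop ⌈‖x‖⌉₊] with n hn
    rw [hgi, Set.indicator_of_mem]
    exact mem_closedBall_zero_iff.2 ((Nat.le_ceil _).trans (by exact_mod_cast hn))
  have hfib : ∀ n c, c ≠ 0 → volume (g n ⁻¹' {c}) ≠ ∞ := by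
    intro n c hc
    refine ((measure_mono ?_).trans_lt (measure_closedBall_lt_top (x := (0 : Plane)) (r := n))).ne
    intro x hx
    by_contra hxB
    have : g n x = 0 := by rw [hgi, Set.indicator_of_notMem hxB]
    exact hc (by rw [← this]; exact hx.symm)
  have hL : Tendsto (fun n => ∫⁻ y, expNeg (∑' j, g n (y j)) ∂Φ) atTop
      (𝓝 (∫⁻ y, expNeg (∑' j, f (y j)) ∂Φ)) := by
    refine tendsto_lintegral_of_dominated_convergence (fun _ => 1) (fun n => ?_)
      (fun n => ae_of_all _ fun y => expNeg_le_one _) (by simp) (ae_of_all _ fun y => ?_)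
    · exact measurable_expNeg.comp
        (Measurable.tsum fun j => (g n).measurable.comp (measurable_pi_apply j))
    · exact (continuous_expNeg.tendsto _).comp
        (tendsto_tsum_of_monotone (fun j => hmono (y j)) fun j => htend (y j))
  have hR : Tendsto (fun n => expNeg (ENNReal.ofReal m * ∫⁻ x, (1 - expNeg (g n x)))) atTop
      (𝓝 (expNeg (ENNReal.ofReal m * ∫⁻ x, (1 - expNeg (f x))))) := by
    refine (continuous_expNeg.tendsto _).comp
      (ENNReal.Tendsto.const_mul ?_ (Or.inr ENNReal.ofReal_ne_top))
    refine lintegral_tendsto_of_tendsto_of_monotone (fun n => ?_)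
      (ae_of_all _ fun x a b hab => tsub_le_tsub_left (expNeg_antitone (hmono x hab)) _)
      (ae_of_all _ fun x => ?_)
    · exact (measurable_const.sub (measurable_expNeg.comp (g n).measurable)).aemeasurable
    · exact ENNReal.Tendsto.sub tendsto_const_nhds
        ((continuous_expNeg.tendsto _).comp (htend x)) (Or.inl ENNReal.one_ne_top)
  refine tendsto_nhds_unique hL (hR.congr fun n => ?_)
  exact (hΦ.lintegral_expNeg_tsum_simpleFunc hm (g n) (hfib n)).symm

end IsPoissonPointProcess

/-- The Laplace transform of a finite sum of functions of independent marks. -/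
lemma lintegral_expNeg_sum_infinitePi {M : Type*} [MeasurableSpace M] (ν : Measure M)
    [IsProbabilityMeasure ν] {w : ℕ → M → ℝ≥0∞} (hw : ∀ j, Measurable (w j)) (n : ℕ) :
    ∫⁻ z, expNeg (∑ j ∈ Finset.range n, w j (z j)) ∂(Measure.infinitePi fun _ : ℕ => ν) =
      ∏ j ∈ Finset.range n, ∫⁻ a, expNeg (w j a) ∂ν := by
  simp_rw [expNeg_sum]
  have hind : iIndepFun (fun j (z : ℕ → M) => expNeg (w j (z j)))
      (Measure.infinitePi fun _ : ℕ => ν) :=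
    iIndepFun_infinitePi (X := fun j a => expNeg (w j a))
      (fun j => measurable_expNeg.comp (hw j))
  rw [lintegral_prod_eq_prod_lintegral_of_indepFun _ _ hind
    (fun j => measurable_expNeg.comp ((hw j).comp (measurable_pi_apply j)))]
  exact Finset.prod_congr rfl fun j _ =>
    (measurePreserving_eval_infinitePi (fun _ : ℕ => ν) j).lintegral_comp
      (measurable_expNeg.comp (hw j))

/-- Averaging over independent marks turns the exponential of a sum over all points into that of
a sum of effective weights. -/
lemma lintegral_expNeg_tsum_infinitePi {M : Type*} [MeasurableSpace M] (ν : Measure M)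
    [IsProbabilityMeasure ν] {w : ℕ → M → ℝ≥0∞} (hw : ∀ j, Measurable (w j)) :
    ∫⁻ z, expNeg (∑' j, w j (z j)) ∂(Measure.infinitePi fun _ : ℕ => ν) =
      expNeg (∑' j, negLog (∫⁻ a, expNeg (w j a) ∂ν)) := by
  have hfin : ∀ n : ℕ, ∫⁻ z, expNeg (∑ j ∈ Finset.range n, w j (z j))
      ∂(Measure.infinitePi fun _ : ℕ => ν) =
      expNeg (∑ j ∈ Finset.range n, negLog (∫⁻ a, expNeg (w j a) ∂ν)) := by
    intro n
    rw [lintegral_expNeg_sum_infinitePi ν hw, expNeg_sum]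
    refine Finset.prod_congr rfl fun j _ => (expNeg_negLog ?_).symm
    exact (lintegral_mono fun a => expNeg_le_one _).trans (by simp)
  refine tendsto_nhds_unique (f := fun n : ℕ => ∫⁻ z, expNeg (∑ j ∈ Finset.range n, w j (z j))
      ∂(Measure.infinitePi fun _ : ℕ => ν)) (l := atTop) ?_ ?_
  · refine tendsto_lintegral_of_dominated_convergence (fun _ => 1) (fun n => ?_)
      (fun n => ae_of_all _ fun y => expNeg_le_one _) (by simp) (ae_of_all _ fun y => ?_)
    · exact measurable_expNeg.comp
        (Finset.measurable_sum _ fun j _ => (hw j).comp (measurable_pi_apply j))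
    · exact (continuous_expNeg.tendsto _).comp (ENNReal.tendsto_nat_tsum _)
  · simp_rw [hfin]
    exact (continuous_expNeg.tendsto _).comp (ENNReal.tendsto_nat_tsum _)

/-- The Laplace functional of an independently marked Poisson point process. -/
lemma IsPoissonPointProcess.lintegral_expNeg_tsum_marked {m : ℝ} {Φ : Measure (ℕ → Plane)}
    (hm : 0 ≤ m) (hΦ : IsPoissonPointProcess m Φ) {M : Type*} [MeasurableSpace M] (ν : Measure M)
    [IsProbabilityMeasure ν] {w : Plane → M → ℝ≥0∞} (hw : Measurable (Function.uncurry w)) :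
    ∫⁻ y, ∫⁻ z, expNeg (∑' j, w (y j) (z j)) ∂(Measure.infinitePi fun _ : ℕ => ν) ∂Φ =
      expNeg (ENNReal.ofReal m * ∫⁻ x, ∫⁻ a, (1 - expNeg (w x a)) ∂ν) := by
  have hwx : ∀ x, Measurable (w x) := fun x => hw.of_uncurry_left
  have hle : ∀ x, ∫⁻ a, expNeg (w x a) ∂ν ≤ 1 := fun x =>
    (lintegral_mono fun a => expNeg_le_one _).trans (by simp)
  have hmeas : Measurable fun x => negLog (∫⁻ a, expNeg (w x a) ∂ν) :=
    measurable_negLog.comp (measurable_expNeg.comp hw).lintegral_prod_right'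
  simp_rw [fun y : ℕ → Plane => lintegral_expNeg_tsum_infinitePi ν (fun j => hwx (y j))]
  rw [hΦ.lintegral_expNeg_tsum hm hmeas]
  congr 2
  refine lintegral_congr fun x => ?_
  have hm' : Measurable fun a => expNeg (w x a) := measurable_expNeg.comp (hwx x)
  rw [expNeg_negLog (hle x), lintegral_sub hm'
    ((hle x).trans_lt ENNReal.one_lt_top).ne (ae_of_all _ fun a => expNeg_le_one _)]
  simp

/-! ### The nearest point of a Poisson point process -/

lemma measurable_nearestPoint : Measurable nearestPoint := by
  classical
  have hp : ∀ j : ℕ, MeasurableSet {ψ : ℕ → Plane | ∀ l, ‖ψ j‖ ≤ ‖ψ l‖} := fun j => by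
    rw [Set.ofPred_forall]
    exact MeasurableSet.iInter fun l => measurableSet_le (by fun_prop) (by fun_prop)
  have hE : MeasurableSet {ψ : ℕ → Plane | ∃ j, ∀ l, ‖ψ j‖ ≤ ‖ψ l‖} := by
    rw [Set.ofPred_exists]
    exact MeasurableSet.iUnion hp
  unfold nearestPoint
  refine Measurable.dite (s := {ψ : ℕ → Plane | ∃ j, ∀ l, ‖ψ j‖ ≤ ‖ψ l‖})
    (f := fun ψ => ψ.1 (Nat.find ψ.2)) (g := fun _ => 0) ?_ measurable_const hE
  exact Measurable.find (f := fun j (ψ : {ψ : ℕ → Plane | ∃ j, ∀ l, ‖ψ j‖ ≤ ‖ψ l‖}) => ψ.1 j)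
    (p := fun j ψ => ∀ l, ‖ψ.1 j‖ ≤ ‖ψ.1 l‖)
    (fun j => (measurable_pi_apply j).comp measurable_subtype_coe)
    (fun j => measurable_subtype_coe (hp j)) (fun ψ => ψ.2)

lemma pointCount_eq_zero {B : Set Plane} {y : ℕ → Plane} :
    pointCount B y = 0 ↔ ∀ j, y j ∉ B := by
  simp [pointCount, ENNReal.tsum_eq_zero]

/-- If the configuration has finitely many points in a ball and at least one, then a nearest point
exists. -/
lemma exists_nearest {ψ : ℕ → Plane} {r : ℝ} (h0 : pointCount (Metric.closedBall 0 r) ψ ≠ 0)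
    (h1 : pointCount (Metric.closedBall 0 r) ψ ≠ ∞) : ∃ j, ∀ l, ‖ψ j‖ ≤ ‖ψ l‖ := by
  have hfin : {j | ψ j ∈ Metric.closedBall (0 : Plane) r}.Finite := by
    refine (ENNReal.finite_const_le_of_tsum_ne_top h1 one_ne_zero).subset fun j hj => ?_
    have hj : ψ j ∈ Metric.closedBall (0 : Plane) r := hj
    simp [Set.indicator_of_mem hj]
  have hne : {j | ψ j ∈ Metric.closedBall (0 : Plane) r}.Nonempty := by
    by_contra hemp
    exact h0 (pointCount_eq_zero.2 fun j hj => hemp ⟨j, hj⟩)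
  obtain ⟨j, hj, hmin⟩ := Set.exists_min_image _ (fun j => ‖ψ j‖) hfin hne
  refine ⟨j, fun l => ?_⟩
  by_cases hl : ψ l ∈ Metric.closedBall (0 : Plane) r
  · exact hmin l hl
  · have h2 : ‖ψ j‖ ≤ r := mem_closedBall_zero_iff.1 hj
    have h3 : r < ‖ψ l‖ := by simpa using hl
    linarith

lemma lt_norm_nearestPoint_iff {ψ : ℕ → Plane} (h : ∃ j, ∀ l, ‖ψ j‖ ≤ ‖ψ l‖) (r : ℝ) :
    r < ‖nearestPoint ψ‖ ↔ pointCount (Metric.closedBall 0 r) ψ = 0 := by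
  classical
  rw [pointCount_eq_zero, nearestPoint, dif_pos h]
  simp only [mem_closedBall_zero_iff, not_le]
  exact ⟨fun hr l => hr.trans_le (Nat.find_spec h l), fun hr => hr _⟩

lemma volume_real_closedBall {r : ℝ} (hr : 0 ≤ r) :
    volume.real (Metric.closedBall (0 : Plane) r) = Real.pi * r ^ 2 := by
  rw [measureReal_def, EuclideanSpace.volume_closedBall_fin_two, ENNReal.toReal_mul,
    ENNReal.toReal_pow, ENNReal.toReal_ofReal hr, ENNReal.toReal_ofReal Real.pi_pos.le, mul_comm]

namespace IsPoissonPointProcess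

variable {m : ℝ} {Ψ : Measure (ℕ → Plane)}

lemma measure_pointCount_eq_zero (hm : 0 ≤ m) (hΨ : IsPoissonPointProcess m Ψ) {B : Set Plane}
    (hB : MeasurableSet B) (hvol : volume B ≠ ∞) :
    Ψ {ψ | pointCount B ψ = 0} = ENNReal.ofReal (Real.exp (-(m * volume.real B))) := by
  have h : Ψ {ψ | pointCount B ψ = 0} = (Ψ.map (pointCount B)) {0} :=
    (Measure.map_apply (measurable_pointCount hB) (measurableSet_singleton 0)).symm
  have h0 : (fun n : ℕ => (n : ℝ≥0∞)) ⁻¹' {0} = {0} := by ext n; simp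
  rw [h, hΨ.count_law B hB hvol, Measure.map_apply .of_discrete (measurableSet_singleton 0), h0,
    poissonMeasure_singleton, Real.coe_toNNReal _ (by positivity)]
  simp

lemma ae_pointCount_ne_top (hΨ : IsPoissonPointProcess m Ψ) {B : Set Plane}
    (hB : MeasurableSet B) (hvol : volume B ≠ ∞) : ∀ᵐ ψ ∂Ψ, pointCount B ψ ≠ ∞ := by
  have h : Ψ {ψ | pointCount B ψ = ∞} = (Ψ.map (pointCount B)) {∞} :=
    (Measure.map_apply (measurable_pointCount hB) (measurableSet_singleton ∞)).symm
  have h0 : (fun n : ℕ => (n : ℝ≥0∞)) ⁻¹' {∞} = ∅ := by ext n; simp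
  rw [ae_iff]
  simp only [ne_eq, not_not]
  rw [h, hΨ.count_law B hB hvol, Measure.map_apply .of_discrete (measurableSet_singleton ∞), h0,
    measure_empty]

lemma ae_exists_nearest (hm : 0 < m) (hΨ : IsPoissonPointProcess m Ψ) :
    ∀ᵐ ψ ∂Ψ, ∃ j, ∀ l, ‖ψ j‖ ≤ ‖ψ l‖ := by
  have hvol : ∀ r : ℝ, volume (Metric.closedBall (0 : Plane) r) ≠ ∞ := fun r =>
    measure_closedBall_lt_top.ne
  have hfin : ∀ᵐ ψ ∂Ψ, ∀ n : ℕ, pointCount (Metric.closedBall 0 n) ψ ≠ ∞ :=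
    ae_all_iff.2 fun n => hΨ.ae_pointCount_ne_top measurableSet_closedBall (hvol _)
  have hpos : ∀ᵐ ψ ∂Ψ, ∃ n : ℕ, pointCount (Metric.closedBall 0 n) ψ ≠ 0 := by
    rw [ae_iff]
    simp only [not_exists, ne_eq, not_not]
    have hle : ∀ n : ℕ, Ψ {ψ | ∀ n : ℕ, pointCount (Metric.closedBall 0 n) ψ = 0} ≤
        ENNReal.ofReal (Real.exp (-(m * Real.pi * (n : ℝ) ^ 2))) := fun n => by
      have := hΨ.measure_pointCount_eq_zero hm.le measurableSet_closedBall (hvol n)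
      rw [volume_real_closedBall n.cast_nonneg, ← mul_assoc] at this
      rw [← this]
      exact measure_mono fun ψ hψ => hψ n
    have hlim : Tendsto (fun n : ℕ => ENNReal.ofReal (Real.exp (-(m * Real.pi * (n : ℝ) ^ 2))))
        atTop (𝓝 0) := by
      rw [← ENNReal.ofReal_zero]
      refine (ENNReal.continuous_ofReal.tendsto 0).comp
        (Real.tendsto_exp_neg_atTop_nhds_zero.comp ?_)
      exact Tendsto.const_mul_atTop (by positivity)
        ((tendsto_pow_atTop two_ne_zero).comp tendsto_natCast_atTop_atTop)
    exact le_antisymm (ge_of_tendsto' hlim hle) zero_le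
  filter_upwards [hfin, hpos] with ψ h1 ⟨n, h2⟩
  exact exists_nearest h2 (h1 n)

/-- The distance to the nearest point of a Poisson point process has a Rayleigh distribution. -/
lemma measure_lt_norm_nearestPoint (hm : 0 < m) (hΨ : IsPoissonPointProcess m Ψ) {r : ℝ}
    (hr : 0 ≤ r) :
    Ψ {ψ | r < ‖nearestPoint ψ‖} = ENNReal.ofReal (Real.exp (-(m * Real.pi * r ^ 2))) := by
  have h := hΨ.measure_pointCount_eq_zero hm.le (B := Metric.closedBall (0 : Plane) r)
    measurableSet_closedBall measure_closedBall_lt_top.ne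
  rw [volume_real_closedBall hr, ← mul_assoc] at h
  rw [← h]
  refine measure_congr ?_
  filter_upwards [hΨ.ae_exists_nearest hm] with ψ hψ
  exact propext (lt_norm_nearestPoint_iff hψ r)

lemma lintegral_sq_norm_nearestPoint (hm : 0 < m) (hΨ : IsPoissonPointProcess m Ψ) :
    ∫⁻ ψ, ENNReal.ofReal (‖nearestPoint ψ‖ ^ 2) ∂Ψ = ENNReal.ofReal (1 / (m * Real.pi)) := by
  have hmeas := measurable_nearestPoint
  have hneg : -(m * Real.pi) < 0 := by
    have := Real.pi_pos
    have : 0 < m * Real.pi := by positivity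
    linarith
  rw [lintegral_eq_lintegral_meas_lt Ψ (ae_of_all _ fun ψ => by positivity)
    (by fun_prop : Measurable fun ψ => ‖nearestPoint ψ‖ ^ 2).aemeasurable]
  have h : ∀ t ∈ Set.Ioi (0 : ℝ), Ψ {ψ | t < ‖nearestPoint ψ‖ ^ 2} =
      ENNReal.ofReal (Real.exp (-(m * Real.pi) * t)) := by
    intro t ht
    have ht : 0 < t := ht
    have := hΨ.measure_lt_norm_nearestPoint hm (Real.sqrt_nonneg t)
    rw [Real.sq_sqrt ht.le, ← neg_mul] at this
    rw [← this]
    congr 1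
    ext ψ
    rw [Set.mem_ofPred_eq, Set.mem_ofPred_eq, ← Real.sqrt_lt_sqrt_iff ht.le,
      Real.sqrt_sq (norm_nonneg _)]
  rw [setLIntegral_congr_fun measurableSet_Ioi h,
    ← ofReal_integral_eq_lintegral_ofReal (integrableOn_exp_mul_Ioi hneg 0)
      (ae_of_all _ fun t => (Real.exp_pos _).le), integral_exp_mul_Ioi hneg]
  congr 1
  simp

end IsPoissonPointProcess

/-! ### Euler's integral for the hypergeometric function -/

/-- The integral `∫₀¹ (1 - z s ^ β)⁻¹ ds`, which represents `₂F₁(1, 1 / β; 1 + 1 / β; z)`. -/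
noncomputable def eulerIntegral (β z : ℝ) : ℝ := ∫ s in (0 : ℝ)..1, (1 - z * s ^ β)⁻¹

lemma min_le_one_sub_mul {z t : ℝ} (ht : t ∈ Set.Icc (0 : ℝ) 1) : min 1 (1 - z) ≤ 1 - z * t := by
  rcases le_total z 0 with hz | hz
  · exact (min_le_left _ _).trans (by nlinarith [ht.1])
  · exact (min_le_right _ _).trans (by nlinarith [ht.2])

lemma rpow_mem_Icc {β s : ℝ} (hβ : 0 ≤ β) (hs : s ∈ Set.Ioc (0 : ℝ) 1) :
    s ^ β ∈ Set.Icc (0 : ℝ) 1 :=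
  ⟨Real.rpow_nonneg hs.1.le _, Real.rpow_le_one hs.1.le hs.2 hβ⟩

/-- The power series expansion of `eulerIntegral` about a point `z₀ < 1`. -/
lemma hasSum_eulerIntegral {β z₀ z : ℝ} (hβ : 0 ≤ β) (hz₀ : z₀ < 1)
    (hz : |z - z₀| < min 1 (1 - z₀)) :
    HasSum (fun n : ℕ => (z - z₀) ^ n *
      ∫ s in (0 : ℝ)..1, (s ^ β) ^ n / (1 - z₀ * s ^ β) ^ (n + 1)) (eulerIntegral β z) := by
  set d := min 1 (1 - z₀) with hd
  have hd0 : 0 < d := lt_min one_pos (by linarith)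
  have hq : |z - z₀| / d < 1 := (div_lt_one hd0).2 hz
  have hq0 : 0 ≤ |z - z₀| / d := by positivity
  simp_rw [← intervalIntegral.integral_const_mul]
  refine intervalIntegral.hasSum_integral_of_dominated_convergence
    (fun n _ => d⁻¹ * (|z - z₀| / d) ^ n) (fun n => ?_) (fun n => ?_) ?_ ?_ ?_
  · exact Measurable.aestronglyMeasurable (by fun_prop)
  · refine ae_of_all _ fun s hs => ?_
    rw [Set.uIoc_of_le zero_le_one] at hs
    have ht := rpow_mem_Icc hβ hs
    have h1 := min_le_one_sub_mul (z := z₀) ht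
    have h2 : 0 < 1 - z₀ * s ^ β := hd0.trans_le h1
    rw [Real.norm_eq_abs, abs_mul, abs_pow, abs_div, abs_pow, abs_pow, abs_of_nonneg ht.1,
      abs_of_pos h2, div_pow, ← div_eq_inv_mul, div_div, ← pow_succ, ← mul_div_assoc]
    gcongr
    exact mul_le_of_le_one_right (by positivity) (pow_le_one₀ ht.1 ht.2)
  · exact ae_of_all _ fun s hs => (summable_geometric_of_lt_one hq0 hq).mul_left _
  · simp
  · refine ae_of_all _ fun s hs => ?_
    rw [Set.uIoc_of_le zero_le_one] at hs
    have ht := rpow_mem_Icc hβ hs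
    have h1 := min_le_one_sub_mul (z := z₀) ht
    have h2 : 0 < 1 - z₀ * s ^ β := hd0.trans_le h1
    have h3 : |(z - z₀) * s ^ β / (1 - z₀ * s ^ β)| < 1 := by
      rw [abs_div, abs_mul, abs_of_nonneg ht.1, abs_of_pos h2, div_lt_one h2]
      exact (mul_le_of_le_one_right (abs_nonneg _) ht.2).trans_lt (hz.trans_le h1)
    have h := (hasSum_geometric_of_abs_lt_one h3).mul_left (1 - z₀ * s ^ β)⁻¹
    have e1 : ∀ n : ℕ, (1 - z₀ * s ^ β)⁻¹ * ((z - z₀) * s ^ β / (1 - z₀ * s ^ β)) ^ n =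
        (z - z₀) ^ n * ((s ^ β) ^ n / (1 - z₀ * s ^ β) ^ (n + 1)) := by
      intro n
      rw [div_pow, mul_pow, pow_succ]
      field_simp
    have e2 : (1 - z₀ * s ^ β)⁻¹ * (1 - (z - z₀) * s ^ β / (1 - z₀ * s ^ β))⁻¹ =
        (1 - z * s ^ β)⁻¹ := by
      rw [← mul_inv]
      congr 1
      field_simp
      ring
    simpa only [e1, e2] using h

lemma analyticOnNhd_eulerIntegral {β : ℝ} (hβ : 0 ≤ β) :
    AnalyticOnNhd ℝ (eulerIntegral β) (Set.Iio 1) := by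
  intro z₀ hz₀
  have hz₀ : z₀ < 1 := hz₀
  refine ⟨FormalMultilinearSeries.ofScalars ℝ fun n : ℕ =>
    ∫ s in (0 : ℝ)..1, (s ^ β) ^ n / (1 - z₀ * s ^ β) ^ (n + 1), ?_⟩
  rw [hasFPowerSeriesAt_iff']
  have hd0 : 0 < min 1 (1 - z₀) := lt_min one_pos (by linarith)
  filter_upwards [Metric.ball_mem_nhds z₀ hd0] with z hz
  simp_rw [FormalMultilinearSeries.coeff_ofScalars, smul_eq_mul]
  exact hasSum_eulerIntegral hβ hz₀ (by simpa [Real.dist_eq] using hz)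

lemma ascPochhammer_eval_succ_left (n : ℕ) (b : ℝ) :
    (ascPochhammer ℝ n).eval b * (b + n) = (ascPochhammer ℝ n).eval (b + 1) * b := by
  rw [← ascPochhammer_succ_eval, ascPochhammer_succ_left]
  simp [mul_comm]

/-- Euler's integral represents the hypergeometric function, in the variable `s = t ^ b`. -/
lemma isGaussHypergeometric_eulerIntegral {b : ℝ} (hb : 0 < b) :
    IsGaussHypergeometric 1 b (b + 1) (eulerIntegral b⁻¹) := by
  have hβ : 0 ≤ b⁻¹ := by positivity
  refine ⟨analyticOnNhd_eulerIntegral hβ, fun z hz => ?_⟩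
  have h := hasSum_eulerIntegral hβ zero_lt_one (z := z) (by simpa [abs_lt] using hz)
  convert h using 2 with n
  have hint : ∫ s in (0 : ℝ)..1, (s ^ b⁻¹) ^ n / (1 - 0 * s ^ b⁻¹) ^ (n + 1) = b / (b + n) := by
    have h1 : ∀ s ∈ Set.uIcc (0 : ℝ) 1, (s ^ b⁻¹) ^ n / (1 - 0 * s ^ b⁻¹) ^ (n + 1) =
        s ^ (b⁻¹ * n) := by
      intro s hs
      rw [Set.uIcc_of_le zero_le_one] at hs
      rw [Real.rpow_mul hs.1, Real.rpow_natCast]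
      simp
    rw [intervalIntegral.integral_congr h1, integral_rpow]
    · have : b⁻¹ * n + 1 ≠ 0 := by positivity
      rw [Real.one_rpow, Real.zero_rpow this]
      field_simp
      ring
    · left
      have : 0 ≤ b⁻¹ * n := by positivity
      linarith
  have hp : 0 < (ascPochhammer ℝ n).eval (b + 1) := ascPochhammer_pos n _ (by linarith)
  have hbn : 0 < b + n := by positivity
  have hfac : (n.factorial : ℝ) ≠ 0 := by positivity
  rw [hint, sub_zero, ascPochhammer_eval_one]
  rw [div_eq_iff (by positivity), ← mul_div_assoc, div_mul_eq_mul_div, eq_div_iff hbn.ne']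
  linear_combination (n.factorial : ℝ) * z ^ n * ascPochhammer_eval_succ_left n b

lemma gaussHypergeometric_eq_eulerIntegral {b z : ℝ} (hb : 0 < b) (hz : z < 1) :
    gaussHypergeometric 1 b (b + 1) z = eulerIntegral b⁻¹ z := by
  have h : ∃ F, IsGaussHypergeometric 1 b (b + 1) F := ⟨_, isGaussHypergeometric_eulerIntegral hb⟩
  rw [gaussHypergeometric, dif_pos h]
  exact h.choose_spec.eqOn (isGaussHypergeometric_eulerIntegral hb) hz

lemma eulerIntegral_two {θ : ℝ} (hθ : 0 < θ) :
    eulerIntegral 2 (-θ) = Real.arctan (√θ) / √θ := by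
  have hs : √θ ≠ 0 := (Real.sqrt_pos.2 hθ).ne'
  have h : ∀ s : ℝ, (1 - -θ * s ^ (2 : ℝ))⁻¹ = (1 + (√θ * s) ^ 2)⁻¹ := by
    intro s
    rw [Real.rpow_two, mul_pow, Real.sq_sqrt hθ.le]
    ring_nf
  simp_rw [eulerIntegral, h]
  rw [intervalIntegral.integral_comp_mul_left (fun u : ℝ => (1 + u ^ 2)⁻¹) hs,
    integral_inv_one_add_sq]
  simp [div_eq_inv_mul]

/-! ### The radial integral -/

/-- The mean of `1 - exp (-θ s g)` over an exponential gain `g`, for an interferer that is received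
with average power `s` relative to the typical device. Interferers with `s ≥ 1` are absent, as they
would be served by the base station under consideration. -/
noncomputable def fadingLoss (θ s : ℝ) : ℝ := if s < 1 then θ * s / (1 + θ * s) else 0

lemma fadingLoss_nonneg {θ s : ℝ} (hθ : 0 ≤ θ) (hs : 0 ≤ s) : 0 ≤ fadingLoss θ s := by
  unfold fadingLoss
  split_ifs <;> positivity

@[fun_prop] lemma measurable_fadingLoss (θ : ℝ) : Measurable (fadingLoss θ) :=
  Measurable.ite measurableSet_Iio (by fun_prop) measurable_const

/-- The total loss over the plane, for a device at distance `r` with relative power `r ^ (-η)`. -/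
lemma lintegral_fadingLoss_norm {θ η : ℝ} (hθ : 0 < θ) (hη : 2 < η) :
    ∫⁻ x : Plane, ENNReal.ofReal (fadingLoss θ (‖x‖ ^ (-η))) =
      ENNReal.ofReal (Real.pi * (2 * θ / (η - 2) * eulerIntegral (η / (η - 2)) (-θ))) := by
  have hη2 : 0 < η - 2 := by linarith
  let g : ℝ → ℝ := (Set.Ioc 0 1).indicator fun s => (1 - -θ * s ^ (η / (η - 2)))⁻¹
  have hgint : Integrable g := by
    rw [integrable_indicator_iff measurableSet_Ioc]
    refine Measure.integrableOn_of_bounded (M := 1) (by simp) (by fun_prop) ?_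
    refine (ae_restrict_iff' measurableSet_Ioc).2 (ae_of_all _ fun s hs => ?_)
    have : 0 ≤ θ * s ^ (η / (η - 2)) := mul_nonneg hθ.le (Real.rpow_nonneg hs.1.le _)
    rw [Real.norm_eq_abs, abs_inv, abs_of_pos (by linarith)]
    exact inv_le_one_of_one_le₀ (by linarith)
  -- the substitution `s = r ^ (2 - η)` in polar coordinates
  have hsub : ∀ r ∈ Set.Ioi (0 : ℝ), r ≠ 1 →
      r ^ (Module.finrank ℝ Plane - 1) • fadingLoss θ (r ^ (-η)) =
      θ / (η - 2) * ((|2 - η| * r ^ (2 - η - 1)) • g (r ^ (2 - η))) := by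
    intro r hr hr1
    have hr : 0 < r := hr
    have habs : |2 - η| = η - 2 := by rw [abs_of_neg (by linarith)]; ring
    have hpow : (r ^ (2 - η)) ^ (η / (η - 2)) = r ^ (-η) := by
      rw [← Real.rpow_mul hr.le]
      congr 1
      field_simp
      ring
    rcases lt_or_gt_of_ne hr1 with h1 | h1
    · have h2 : 1 < r ^ (-η) := Real.one_lt_rpow_of_pos_of_lt_one_of_neg hr h1 (by linarith)
      have h3 : 1 < r ^ (2 - η) := Real.one_lt_rpow_of_pos_of_lt_one_of_neg hr h1 (by linarith)
      simp only [g]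
      rw [fadingLoss, if_neg h2.not_gt, Set.indicator_of_notMem (fun h => h3.not_ge h.2)]
      simp
    · have h2 : r ^ (-η) < 1 := Real.rpow_lt_one_of_one_lt_of_neg h1 (by linarith)
      have h3 : r ^ (2 - η) < 1 := Real.rpow_lt_one_of_one_lt_of_neg h1 (by linarith)
      have h4 : 0 < r ^ (-η) := Real.rpow_pos_of_pos hr _
      have h5 : r ^ (2 - η - 1) = r * r ^ (-η) := by
        rw [show 2 - η - 1 = 1 + -η by ring, Real.rpow_add hr, Real.rpow_one]
      have h7 : r ^ (2 - η) ∈ Set.Ioc (0 : ℝ) 1 := ⟨Real.rpow_pos_of_pos hr _, h3.le⟩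
      simp only [g]
      rw [fadingLoss, if_pos h2, Set.indicator_of_mem h7, hpow, h5,
        habs, finrank_euclideanSpace_fin]
      simp only [smul_eq_mul, Nat.add_one_sub_one, pow_one]
      have : 1 - -θ * r ^ (-η) ≠ 0 := by nlinarith
      have h6 : 1 + θ * r ^ (-η) = 1 - -θ * r ^ (-η) := by ring
      rw [h6]
      field_simp
  have hae : ∀ᵐ r ∂(volume.restrict (Set.Ioi (0 : ℝ))),
      r ^ (Module.finrank ℝ Plane - 1) • fadingLoss θ (r ^ (-η)) =
      θ / (η - 2) * ((|2 - η| * r ^ (2 - η - 1)) • g (r ^ (2 - η))) := by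
    rw [ae_restrict_iff' measurableSet_Ioi]
    filter_upwards [Measure.ae_ne volume (1 : ℝ)] with r hr1 hr
    exact hsub r hr hr1
  have hint : Integrable fun x : Plane => fadingLoss θ (‖x‖ ^ (-η)) := by
    rw [integrable_fun_norm_addHaar volume (f := fun r => fadingLoss θ (r ^ (-η)))]
    refine Integrable.congr (Integrable.const_mul ?_ _) (hae.mono fun r hr => hr.symm)
    exact (integrableOn_Ioi_comp_rpow_iff g (by linarith)).2 hgint.integrableOn
  rw [← ofReal_integral_eq_lintegral_ofReal hint
    (ae_of_all _ fun x => fadingLoss_nonneg hθ.le (by positivity)),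
    integral_fun_norm_addHaar volume (fun r => fadingLoss θ (r ^ (-η))), integral_congr_ae hae,
    integral_const_mul, integral_comp_rpow_Ioi g (by linarith)]
  have hg : ∫ y in Set.Ioi (0 : ℝ), g y = eulerIntegral (η / (η - 2)) (-θ) := by
    rw [eulerIntegral, intervalIntegral.integral_of_le zero_le_one,
      setIntegral_indicator measurableSet_Ioc,
      Set.inter_eq_self_of_subset_right Set.Ioc_subset_Ioi_self]
  have hball : volume.real (Metric.ball (0 : Plane) 1) = Real.pi := by
    rw [measureReal_def, EuclideanSpace.volume_ball_fin_two]
    simp [Real.pi_pos.le]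
  rw [hg, hball, finrank_euclideanSpace_fin]
  congr 1
  simp only [nsmul_eq_mul, smul_eq_mul]
  push_cast
  ring

/-- Scaling of the total loss: a device with transmit power `R ^ η` has an influence area that is
proportional to `R ^ 2`. -/
lemma lintegral_fadingLoss_scaled {θ η R : ℝ} (hη : 2 < η) (hR : 0 ≤ R) :
    ∫⁻ x : Plane, ENNReal.ofReal (fadingLoss θ (R ^ η * ‖x‖ ^ (-η))) =
      ENNReal.ofReal (R ^ 2) * ∫⁻ x : Plane, ENNReal.ofReal (fadingLoss θ (‖x‖ ^ (-η))) := by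
  rcases hR.eq_or_lt with rfl | hR
  · simp [Real.zero_rpow (by linarith : η ≠ 0), fadingLoss]
  · have h : ∀ x : Plane, R ^ η * ‖x‖ ^ (-η) = ‖R⁻¹ • x‖ ^ (-η) := by
      intro x
      rw [norm_smul, Real.norm_eq_abs, abs_of_pos (inv_pos.2 hR),
        Real.mul_rpow (by positivity) (norm_nonneg _), Real.inv_rpow hR.le, Real.rpow_neg hR.le,
        inv_inv]
    simp_rw [h]
    rw [← lintegral_map (μ := volume) (g := fun x : Plane => R⁻¹ • x)
      (f := fun x => ENNReal.ofReal (fadingLoss θ (‖x‖ ^ (-η)))) (by fun_prop) (by fun_prop),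
      Measure.map_addHaar_smul volume (inv_ne_zero hR.ne'), lintegral_smul_measure,
      finrank_euclideanSpace_fin, smul_eq_mul]
    congr 2
    rw [inv_pow, inv_inv, abs_of_pos (by positivity)]

/-! ### Transmission on a channel -/

lemma exists_isAddressed {N : ℕ} {k : Fin N → ℕ} {q : QueueState k} (hq : q ≠ 0) :
    ∃ l, IsAddressed q l := by
  obtain ⟨i, hi⟩ := Function.ne_iff.1 hq
  obtain ⟨l, hl, hmin⟩ := WellFounded.has_min (wellFounded_lt (α := Fin N)) {l | q l ≠ 0} ⟨i, hi⟩
  exact ⟨l, hl, fun m hm => by_contra fun h => hmin m h hm⟩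

lemma IsAddressed.unique {N : ℕ} {k : Fin N → ℕ} {q : QueueState k} {l l' : Fin N}
    (h : IsAddressed q l) (h' : IsAddressed q l') : l = l' := by
  rcases lt_trichotomy l l' with hl | hl | hl
  · exact absurd (h'.2 l hl) h.1
  · exact hl
  · exact absurd (h.2 l' hl) h'.1

instance {N C : ℕ} {k : Fin N → ℕ} (A : AccessStrategy N C) (π : PMF (QueueState k)) :
    IsProbabilityMeasure (deviceLaw A π) := by
  unfold deviceLaw
  infer_instance

/-- Under shared allocation a device transmits on a given channel with probability
`(1 - δ) / C`, where `δ` is the probability that all queues are empty. -/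
lemma deviceLaw_transmitsOn {N C : ℕ} [NeZero C] {k : Fin N → ℕ} (π : PMF (QueueState k))
    (ch : Fin C) :
    deviceLaw (sharedAccess N C) π {s | TransmitsOn s ch} =
      ENNReal.ofReal ((1 - (π 0).toReal) / C) := by
  have hC : (0 : ℝ) < C := by exact_mod_cast Nat.pos_of_neZero C
  rw [deviceLaw, Measure.prod_apply .of_discrete]
  have h : ∀ q : QueueState k, (Measure.pi fun l => (sharedAccess N C l).toMeasure)
      (Prod.mk q ⁻¹' {s | TransmitsOn s ch}) =
      ({0}ᶜ : Set (QueueState k)).indicator (fun _ => (C : ℝ≥0∞)⁻¹) q := by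
    intro q
    by_cases hq : q = 0
    · rw [Set.indicator_of_notMem (by simpa using hq)]
      have hset : Prod.mk q ⁻¹' {s : DeviceState k C | TransmitsOn s ch} = ∅ := by
        rw [Set.eq_empty_iff_forall_notMem]
        rintro c ⟨l, hl, -⟩
        exact hl.1 (by rw [hq]; rfl)
      rw [hset, measure_empty]
    · rw [Set.indicator_of_mem (by simpa using hq)]
      obtain ⟨l, hl⟩ := exists_isAddressed hq
      have hset : Prod.mk q ⁻¹' {s : DeviceState k C | TransmitsOn s ch} =
          (Function.eval l : (Fin N → Fin C) → Fin C) ⁻¹' {ch} := by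
        ext c
        constructor
        · rintro ⟨l', hl', hc⟩
          rw [hl.unique hl']
          exact hc
        · exact fun hc => ⟨l, hl, hc⟩
      rw [hset, (measurePreserving_eval
          (fun l => (sharedAccess N C l).toMeasure) l).measure_preimage
        (measurableSet_singleton ch).nullMeasurableSet,
        PMF.toMeasure_apply_singleton _ _ (measurableSet_singleton ch)]
      simp [sharedAccess]
  have hπ : π.toMeasure {0}ᶜ = ENNReal.ofReal (1 - (π 0).toReal) := by
    rw [prob_compl_eq_one_sub (measurableSet_singleton _),
      PMF.toMeasure_apply_singleton _ _ (measurableSet_singleton _),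
      ENNReal.ofReal_sub _ ENNReal.toReal_nonneg, ENNReal.ofReal_one,
      ENNReal.ofReal_toReal (PMF.apply_ne_top π 0)]
  rw [lintegral_congr h, lintegral_indicator_const (measurableSet_singleton _).compl, hπ,
    ENNReal.ofReal_div_of_pos hC, ENNReal.ofReal_natCast, mul_comm, div_eq_mul_inv]

/-! ### Loss due to one interferer -/

section OnOff

variable {S : Type*} [MeasurableSpace S] (D : Measure S) [IsProbabilityMeasure D]

open Classical in
/-- The loss due to one device that transmits with probability `D T` and is received, up to
Rayleigh fading, with relative power `t`. -/
lemma lintegral_one_sub_expNeg_onOff {T : Set S} (hT : MeasurableSet T) {t : ℝ} (ht : 0 ≤ t) :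
    ∫⁻ a, (1 - expNeg (if a.2 ∈ T then ENNReal.ofReal (t * a.1) else 0))
        ∂((expMeasure 1).prod D) = D T * ENNReal.ofReal (t / (1 + t)) := by
  have := isProbabilityMeasure_expMeasure one_pos
  have hT' : MeasurableSet {a : ℝ × S | a.2 ∈ T} := measurable_snd hT
  have hm : Measurable fun a : ℝ × S =>
      1 - expNeg (if a.2 ∈ T then ENNReal.ofReal (t * a.1) else 0) :=
    measurable_const.sub (measurable_expNeg.comp
      (Measurable.ite hT' (by fun_prop) measurable_const))
  rw [lintegral_prod _ hm.aemeasurable]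
  have h : ∀ g : ℝ, ∫⁻ s, (1 - expNeg (if s ∈ T then ENNReal.ofReal (t * g) else 0)) ∂D =
      (1 - expNeg (ENNReal.ofReal (t * g))) * D T := by
    intro g
    rw [← lintegral_indicator_const hT]
    refine lintegral_congr fun s => ?_
    by_cases hs : s ∈ T <;> simp [hs]
  have hm' : Measurable fun g : ℝ => expNeg (ENNReal.ofReal (t * g)) := by fun_prop
  rw [lintegral_congr h, lintegral_mul_const _ (by fun_prop), lintegral_sub hm',
    lintegral_expNeg_expMeasure ht, mul_comm, lintegral_const, measure_univ, one_mul,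
    ← ENNReal.ofReal_one, ← ENNReal.ofReal_sub _ (by positivity)]
  · congr 2
    field_simp
    ring
  · rw [lintegral_expNeg_expMeasure ht]
    exact ENNReal.ofReal_ne_top
  · exact ae_of_all _ fun _ => expNeg_le_one _

open Classical in
lemma lintegral_expNeg_onOff {T : Set S} (hT : MeasurableSet T) {t : ℝ} (ht : 0 ≤ t) :
    ∫⁻ a, expNeg (if a.2 ∈ T then ENNReal.ofReal (t * a.1) else 0) ∂((expMeasure 1).prod D) =
      1 - D T * ENNReal.ofReal (t / (1 + t)) := by
  have := isProbabilityMeasure_expMeasure one_pos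
  have hT' : MeasurableSet {a : ℝ × S | a.2 ∈ T} := measurable_snd hT
  have hm : Measurable fun a : ℝ × S =>
      1 - expNeg (if a.2 ∈ T then ENNReal.ofReal (t * a.1) else 0) :=
    measurable_const.sub (measurable_expNeg.comp
      (Measurable.ite hT' (by fun_prop) measurable_const))
  have hle : ∫⁻ a, (1 - expNeg (if a.2 ∈ T then ENNReal.ofReal (t * a.1) else 0))
      ∂((expMeasure 1).prod D) ≤ 1 := (lintegral_mono fun _ => tsub_le_self).trans (by simp)
  have h := lintegral_sub hm (hle.trans_lt ENNReal.one_lt_top).ne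
    (ae_of_all ((expMeasure 1).prod D) fun a => (tsub_le_self : _ ≤ (1 : ℝ≥0∞)))
  rw [lintegral_one_sub_expNeg_onOff D hT ht, lintegral_const, measure_univ, one_mul] at h
  rw [← h]
  exact lintegral_congr fun a =>
    (ENNReal.sub_sub_cancel ENNReal.one_ne_top (expNeg_le_one _)).symm

end OnOff

/-! ### The two interference terms -/

namespace Network

variable (net : Network) {N C : ℕ} {k : Fin N → ℕ}

lemma voronoiShape_pos : 0 < voronoiShape := by norm_num [voronoiShape]

lemma measurable_poissonMeasure_mul (m : ℝ) :
    Measurable fun a : ℝ => poissonMeasure (Real.toNNReal (m * a)) := by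
  refine Measure.measurable_of_measurable_coe _ fun s hs => ?_
  simp only [poissonMeasure]
  simp_rw [Measure.sum_apply _ hs]
  refine Measurable.tsum fun n => ?_
  simp only [Measure.smul_apply, smul_eq_mul]
  fun_prop

instance : IsProbabilityMeasure net.cellCountLaw := by
  have := isProbabilityMeasure_gammaMeasure voronoiShape_pos (mul_pos net.lam_pos voronoiShape_pos)
  refine ⟨?_⟩
  rw [cellCountLaw, Measure.bind_apply .univ (measurable_poissonMeasure_mul _).aemeasurable]
  simp

lemma isProbabilityMeasure_powerLaw {Ψ : Measure (ℕ → Plane)} [IsProbabilityMeasure Ψ] :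
    IsProbabilityMeasure (net.powerLaw Ψ) := by
  have := measurable_nearestPoint
  exact Measure.isProbabilityMeasure_map (by fun_prop)

/-- The generating function of the number of further devices in the cell. -/
lemma lintegral_pow_cellCountLaw {x : ℝ} (hx : x ∈ Set.Icc (0 : ℝ) 1) :
    ∫⁻ n, (1 - ENNReal.ofReal x) ^ n ∂net.cellCountLaw =
      ENNReal.ofReal ((net.lam * voronoiShape / (net.lam * voronoiShape + net.mu * x)) ^
        voronoiShape) := by
  rw [cellCountLaw, Measure.lintegral_bind (measurable_poissonMeasure_mul _).aemeasurable
    (Measurable.of_discrete).aemeasurable]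
  rw [← lintegral_expNeg_gammaMeasure voronoiShape_pos (mul_pos net.lam_pos voronoiShape_pos)
    (mul_nonneg net.mu_pos.le hx.1)]
  refine lintegral_congr fun a => ?_
  rw [lintegral_pow_poissonMeasure _ tsub_le_self, ENNReal.sub_sub_cancel ENNReal.one_ne_top
    (by simpa using hx.2)]
  congr 1
  change ENNReal.ofReal _ * _ = _
  rw [← ENNReal.ofReal_mul' hx.1]
  congr 1
  ring

lemma measurableSet_transmitsOn :
    MeasurableSet {p : DeviceState k C × Fin C | TransmitsOn p.1 p.2} := .of_discrete

lemma measurable_interCell :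
    Measurable fun p : Fin C × Plane × (ℕ → Plane) × (ℕ → ℝ × ℝ × DeviceState k C) =>
      net.interCell p.1 p.2.1 p.2.2.1 p.2.2.2 := by
  unfold interCell
  refine Measurable.tsum fun j => Measurable.ite (MeasurableSet.inter ?_ ?_) ?_ measurable_const
  · have hf : Measurable fun p : Fin C × Plane × (ℕ → Plane) × (ℕ → ℝ × ℝ × DeviceState k C) =>
        ((p.2.2.2 j).2.2, p.1) := by fun_prop
    exact hf measurableSet_transmitsOn
  · have hf : Measurable fun p : Fin C × Plane × (ℕ → Plane) × (ℕ → ℝ × ℝ × DeviceState k C) =>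
        (p.2.2.2 j).1 * ‖p.2.2.1 j - p.2.1‖ ^ (-net.eta) := by fun_prop
    exact measurableSet_lt hf measurable_const
  · fun_prop

lemma measurable_intraCell :
    Measurable fun p : Fin C × ℕ × (ℕ → ℝ × DeviceState k C) =>
      net.intraCell p.1 p.2.1 p.2.2 := by
  classical
  have h : (fun p : Fin C × ℕ × (ℕ → ℝ × DeviceState k C) => net.intraCell p.1 p.2.1 p.2.2) =
      fun p => ∑' j, if j < p.2.1 then (if TransmitsOn (p.2.2 j).2 p.1
        then ENNReal.ofReal (net.rho * (p.2.2 j).1) else 0) else 0 := by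
    funext p
    rw [intraCell, tsum_eq_sum (s := Finset.range p.2.1) (fun j hj => if_neg (by simpa using hj))]
    exact Finset.sum_congr rfl fun j hj => by rw [if_pos (Finset.mem_range.1 hj)]
  rw [h]
  refine Measurable.tsum fun j => Measurable.ite ?_ (Measurable.ite ?_ ?_ measurable_const)
    measurable_const
  · exact measurableSet_lt measurable_const (by fun_prop)
  · have hf : Measurable fun p : Fin C × ℕ × (ℕ → ℝ × DeviceState k C) =>
        ((p.2.2 j).2, p.1) := by fun_prop
    exact hf measurableSet_transmitsOn
  · fun_prop

/-- The Laplace transform of the intra-cell interference. -/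
lemma lintegral_expNeg_intraCell [NeZero C] (π : PMF (QueueState k)) (ch : Fin C) :
    ∫⁻ n, ∫⁻ z, expNeg (ENNReal.ofReal (net.theta / net.rho) * net.intraCell ch n z)
        ∂(Measure.infinitePi fun _ : ℕ => (expMeasure 1).prod (deviceLaw (sharedAccess N C) π))
        ∂net.cellCountLaw =
      ENNReal.ofReal ((net.lam * voronoiShape / (net.lam * voronoiShape +
        net.mu * ((1 - (π 0).toReal) / C * (net.theta / (1 + net.theta))))) ^ voronoiShape) := by
  classical
  have := isProbabilityMeasure_expMeasure one_pos
  have hθ := net.theta_pos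
  have hρ := net.rho_pos
  have hC : (1 : ℝ) ≤ C := by exact_mod_cast Nat.one_le_iff_ne_zero.2 (NeZero.ne C)
  have hδ : (π 0).toReal ≤ 1 :=
    ENNReal.toReal_le_of_le_ofReal zero_le_one (by simpa using π.coe_le_one 0)
  have hδ0 : 0 ≤ (π 0).toReal := ENNReal.toReal_nonneg
  have hq0 : 0 ≤ (1 - (π 0).toReal) / C := div_nonneg (by linarith) (by linarith)
  have hq1 : (1 - (π 0).toReal) / C ≤ 1 := (div_le_one (by linarith)).2 (by linarith)
  have hx1 : net.theta / (1 + net.theta) ≤ 1 := (div_le_one (by positivity)).2 (by linarith)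
  rw [← net.lintegral_pow_cellCountLaw
    ⟨by positivity, mul_le_one₀ hq1 (by positivity) hx1⟩]
  refine lintegral_congr fun n => ?_
  let T : Set (DeviceState k C) := {s | TransmitsOn s ch}
  have hT : MeasurableSet T := .of_discrete
  let w : ℝ × DeviceState k C → ℝ≥0∞ := fun a =>
    if a.2 ∈ T then ENNReal.ofReal (net.theta * a.1) else 0
  have hwm : Measurable w := by
    have hT' : MeasurableSet {a : ℝ × DeviceState k C | a.2 ∈ T} := measurable_snd hT
    exact Measurable.ite hT' (by fun_prop) measurable_const
  have hw : ∀ z : ℕ → ℝ × DeviceState k C,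
      ENNReal.ofReal (net.theta / net.rho) * net.intraCell ch n z =
      ∑ j ∈ Finset.range n, w (z j) := by
    intro z
    rw [intraCell, Finset.mul_sum]
    refine Finset.sum_congr rfl fun j _ => ?_
    rw [mul_ite, mul_zero, ← ENNReal.ofReal_mul (by positivity)]
    refine if_congr Iff.rfl (congrArg _ ?_) rfl
    field_simp
  simp_rw [hw]
  rw [lintegral_expNeg_sum_infinitePi _ (w := fun _ => w) (fun _ => hwm), Finset.prod_const,
    Finset.card_range, lintegral_expNeg_onOff _ hT hθ.le, deviceLaw_transmitsOn,
    ENNReal.ofReal_mul hq0]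

/-- The Laplace transform of the inter-cell interference at a fixed base station. -/
lemma lintegral_expNeg_interCell [NeZero C] {Φ Ψ : Measure (ℕ → Plane)}
    (hΦ : IsPoissonPointProcess net.mu Φ) (hΨ : IsPoissonPointProcess net.lam Ψ)
    (π : PMF (QueueState k)) (ch : Fin C) (z : Plane) :
    ∫⁻ y, ∫⁻ marks, expNeg (ENNReal.ofReal (net.theta / net.rho) * net.interCell ch z y marks)
        ∂(Measure.infinitePi fun _ : ℕ =>
          (net.powerLaw Ψ).prod ((expMeasure 1).prod (deviceLaw (sharedAccess N C) π))) ∂Φ =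
      expNeg (ENNReal.ofReal net.mu * (ENNReal.ofReal ((1 - (π 0).toReal) / C) *
        (ENNReal.ofReal (1 / (net.lam * Real.pi)) * ENNReal.ofReal (Real.pi * (2 * net.theta /
          (net.eta - 2) * eulerIntegral (net.eta / (net.eta - 2)) (-net.theta)))))) := by
  classical
  have := isProbabilityMeasure_expMeasure one_pos
  have := hΨ.isProbabilityMeasure
  have := net.isProbabilityMeasure_powerLaw (Ψ := Ψ)
  have hθ := net.theta_pos
  have hρ := net.rho_pos
  let D := deviceLaw (sharedAccess N C) π
  let T : Set (DeviceState k C) := {s | TransmitsOn s ch}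
  have hT : MeasurableSet T := .of_discrete
  let w : Plane → ℝ × ℝ × DeviceState k C → ℝ≥0∞ := fun x a =>
    ENNReal.ofReal (net.theta / net.rho) *
      if a.2.2 ∈ T ∧ a.1 * ‖x - z‖ ^ (-net.eta) < net.rho
      then ENNReal.ofReal (a.1 * a.2.1 * ‖x - z‖ ^ (-net.eta)) else 0
  have hw : Measurable (Function.uncurry w) := by
    refine (Measurable.ite (MeasurableSet.inter ?_ ?_) ?_ measurable_const).const_mul _
    · have hf : Measurable fun p : Plane × ℝ × ℝ × DeviceState k C => p.2.2.2 := by fun_prop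
      exact hf hT
    · have hf : Measurable fun p : Plane × ℝ × ℝ × DeviceState k C =>
          p.2.1 * ‖p.1 - z‖ ^ (-net.eta) := by fun_prop
      exact measurableSet_lt hf measurable_const
    · fun_prop
  have hI : ∀ y marks, ENNReal.ofReal (net.theta / net.rho) * net.interCell ch z y marks =
      ∑' j, w (y j) (marks j) := by
    intro y marks
    rw [interCell, ← ENNReal.tsum_mul_left]
    rfl
  simp_rw [hI]
  rw [hΦ.lintegral_expNeg_tsum_marked net.mu_pos.le _ hw]
  congr 2
  have hnear := measurable_nearestPoint
  -- the loss caused by a device at `x`, averaged over its power, its fading and its state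
  have hx : ∀ x, ∫⁻ a, (1 - expNeg (w x a)) ∂((net.powerLaw Ψ).prod ((expMeasure 1).prod D)) =
      ∫⁻ ψ, D T * ENNReal.ofReal (fadingLoss net.theta
        (‖nearestPoint ψ‖ ^ net.eta * ‖x - z‖ ^ (-net.eta))) ∂Ψ := by
    intro x
    have hm : Measurable fun a => 1 - expNeg (w x a) :=
      measurable_const.sub (measurable_expNeg.comp hw.of_uncurry_left)
    rw [lintegral_prod _ hm.aemeasurable, powerLaw,
      lintegral_map hm.lintegral_prod_right' (by fun_prop)]
    refine lintegral_congr fun ψ => ?_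
    set τ := ‖nearestPoint ψ‖ ^ net.eta * ‖x - z‖ ^ (-net.eta) with hτ
    have hτ0 : 0 ≤ τ := by positivity
    have ht0 : 0 ≤ if τ < 1 then net.theta * τ else 0 := by split_ifs <;> positivity
    have hloss : fadingLoss net.theta τ =
        (if τ < 1 then net.theta * τ else 0) / (1 + if τ < 1 then net.theta * τ else 0) := by
      unfold fadingLoss
      split_ifs <;> simp
    rw [hloss, ← lintegral_one_sub_expNeg_onOff D hT ht0]
    refine lintegral_congr fun a => ?_
    congr 2
    have hcond : net.rho * ‖nearestPoint ψ‖ ^ net.eta * ‖x - z‖ ^ (-net.eta) < net.rho ↔ τ < 1 := by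
      rw [mul_assoc, ← hτ]
      exact mul_lt_iff_lt_one_right hρ
    simp only [w, hcond]
    by_cases ha : a.2 ∈ T <;> by_cases h1 : τ < 1 <;> simp only [ha, h1, true_and, false_and,
      if_true, if_false, mul_zero, zero_mul, ENNReal.ofReal_zero]
    rw [← ENNReal.ofReal_mul (by positivity), hτ]
    congr 1
    field_simp
  rw [lintegral_congr hx, lintegral_lintegral_swap (by fun_prop)]
  have hψ : ∀ ψ : ℕ → Plane, ∫⁻ x, D T * ENNReal.ofReal (fadingLoss net.theta
        (‖nearestPoint ψ‖ ^ net.eta * ‖x - z‖ ^ (-net.eta))) =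
      D T * (ENNReal.ofReal (‖nearestPoint ψ‖ ^ 2) * ENNReal.ofReal (Real.pi * (2 * net.theta /
          (net.eta - 2) * eulerIntegral (net.eta / (net.eta - 2)) (-net.theta)))) := by
    intro ψ
    rw [lintegral_const_mul _ (by fun_prop), lintegral_sub_right_eq_self (fun x : Plane =>
      ENNReal.ofReal (fadingLoss net.theta (‖nearestPoint ψ‖ ^ net.eta * ‖x‖ ^ (-net.eta)))) z,
      lintegral_fadingLoss_scaled net.two_lt_eta (norm_nonneg _),
      lintegral_fadingLoss_norm hθ net.two_lt_eta]
  rw [lintegral_congr hψ, lintegral_const_mul _ (by fun_prop), lintegral_mul_const _ (by fun_prop),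
    hΨ.lintegral_sq_norm_nearestPoint net.lam_pos, deviceLaw_transmitsOn]

end Network

/-! ### The coverage probability -/

/-- Fubini's theorem for a product of two factors, whose only common variable is the first one. -/
lemma lintegral_mul_mul_const_prod {X₁ X₂ X₃ X₄ X₅ X₆ : Type*} [MeasurableSpace X₁]
    [MeasurableSpace X₂] [MeasurableSpace X₃] [MeasurableSpace X₄] [MeasurableSpace X₅]
    [MeasurableSpace X₆] {m₁ : Measure X₁} {m₂ : Measure X₂} {m₃ : Measure X₃} {m₄ : Measure X₄}
    {m₅ : Measure X₅} {m₆ : Measure X₆} [IsProbabilityMeasure m₁] [IsProbabilityMeasure m₂]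
    [SFinite m₃] [SFinite m₄] [SFinite m₅] [SFinite m₆]
    {G : X₁ × X₂ × X₃ × X₄ → ℝ≥0∞} {H : X₁ × X₅ × X₆ → ℝ≥0∞} {A B : ℝ≥0∞}
    (hG : Measurable G) (hH : Measurable H)
    (hA : ∀ x₁ x₂, ∫⁻ x₃, ∫⁻ x₄, G (x₁, x₂, x₃, x₄) ∂m₄ ∂m₃ = A)
    (hB : ∀ x₁, ∫⁻ x₅, ∫⁻ x₆, H (x₁, x₅, x₆) ∂m₆ ∂m₅ = B) (c : ℝ≥0∞) :
    ∫⁻ r, G (r.1, r.2.1, r.2.2.1, r.2.2.2.1) * H (r.1, r.2.2.2.2.1, r.2.2.2.2.2) * c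
      ∂(m₁.prod (m₂.prod (m₃.prod (m₄.prod (m₅.prod m₆))))) = A * B * c := by
  rw [lintegral_prod _ (by fun_prop)]
  have h₁ : ∀ x₁, ∫⁻ r, G (x₁, r.1, r.2.1, r.2.2.1) * H (x₁, r.2.2.2.1, r.2.2.2.2) * c
      ∂(m₂.prod (m₃.prod (m₄.prod (m₅.prod m₆)))) = A * B * c := by
    intro x₁
    rw [lintegral_prod _ (by fun_prop)]
    have h₂ : ∀ x₂, ∫⁻ r, G (x₁, x₂, r.1, r.2.1) * H (x₁, r.2.2.1, r.2.2.2) * c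
        ∂(m₃.prod (m₄.prod (m₅.prod m₆))) = A * B * c := by
      intro x₂
      rw [lintegral_prod _ (by fun_prop)]
      have h₃ : ∀ x₃, ∫⁻ r, G (x₁, x₂, x₃, r.1) * H (x₁, r.2.1, r.2.2) * c
          ∂(m₄.prod (m₅.prod m₆)) = (∫⁻ x₄, G (x₁, x₂, x₃, x₄) ∂m₄) * (B * c) := by
        intro x₃
        rw [lintegral_prod _ (by fun_prop), ← lintegral_mul_const _ (by fun_prop)]
        refine lintegral_congr fun x₄ => ?_
        dsimp only
        simp_rw [mul_assoc]
        rw [lintegral_const_mul _ (by fun_prop), lintegral_mul_const _ (by fun_prop),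
          lintegral_prod _ (by fun_prop), hB]
      have hG' : Measurable fun x₃ => ∫⁻ x₄, G (x₁, x₂, x₃, x₄) ∂m₄ :=
        Measurable.lintegral_prod_right' (f := fun p : X₃ × X₄ => G (x₁, x₂, p.1, p.2))
          (by fun_prop)
      rw [lintegral_congr h₃, lintegral_mul_const _ hG', hA, mul_assoc]
    rw [lintegral_congr h₂, lintegral_const, measure_univ, mul_one]
  rw [lintegral_congr h₁, lintegral_const, measure_univ, mul_one]

namespace Network

variable (net : Network) {N C : ℕ} {k : Fin N → ℕ}

/-- The coverage probability under shared allocation is the product of the Laplace transforms of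
the two interference terms and of the noise. -/
lemma coverageProb_sharedAccess [NeZero C] {Φ Ψ : Measure (ℕ → Plane)}
    (hΦ : IsPoissonPointProcess net.mu Φ) (hΨ : IsPoissonPointProcess net.lam Ψ)
    (π : PMF (QueueState k)) (i : Fin N) :
    net.coverageProb Φ Ψ (sharedAccess N C) π i =
      (expNeg (ENNReal.ofReal net.mu * (ENNReal.ofReal ((1 - (π 0).toReal) / C) *
        (ENNReal.ofReal (1 / (net.lam * Real.pi)) * ENNReal.ofReal (Real.pi * (2 * net.theta /
          (net.eta - 2) * eulerIntegral (net.eta / (net.eta - 2)) (-net.theta)))))) *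
      ENNReal.ofReal ((net.lam * voronoiShape / (net.lam * voronoiShape +
        net.mu * ((1 - (π 0).toReal) / C * (net.theta / (1 + net.theta))))) ^ voronoiShape) *
      expNeg (ENNReal.ofReal (net.theta / net.rho) * ENNReal.ofReal net.noise)).toReal := by
  have := isProbabilityMeasure_expMeasure one_pos
  have := hΦ.isProbabilityMeasure
  have := hΨ.isProbabilityMeasure
  have := net.isProbabilityMeasure_powerLaw (Ψ := Ψ)
  have hnear := measurable_nearestPoint
  let s := ENNReal.ofReal (net.theta / net.rho)
  let c0 := expNeg (s * ENNReal.ofReal net.noise)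
  -- everything but the channel power gain of the typical device
  let R : Type := Fin C × (ℕ → Plane) × (ℕ → Plane) × (ℕ → ℝ × ℝ × DeviceState k C) ×
    ℕ × (ℕ → ℝ × DeviceState k C)
  let I : R → ℝ≥0∞ := fun r => net.interCell r.1 (nearestPoint r.2.1) r.2.2.1 r.2.2.2.1
  let J : R → ℝ≥0∞ := fun r => net.intraCell r.1 r.2.2.2.2.1 r.2.2.2.2.2
  have hI : Measurable I := net.measurable_interCell.comp (f := fun r : R =>
    (r.1, nearestPoint r.2.1, r.2.2.1, r.2.2.2.1)) (by fun_prop)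
  have hJ : Measurable J := net.measurable_intraCell.comp (f := fun r : R =>
    (r.1, r.2.2.2.2.1, r.2.2.2.2.2)) (by fun_prop)
  let X : R → ℝ≥0∞ := fun r => I r + J r + ENNReal.ofReal net.noise
  have hX : Measurable X := (hI.add hJ).add measurable_const
  have hset : MeasurableSet {p : ℝ × R | ENNReal.ofReal net.theta <
      ENNReal.ofReal (net.rho * p.1) / X p.2} :=
    measurableSet_lt measurable_const
      (Measurable.div (by fun_prop) (hX.comp measurable_snd))
  let F : R → ℝ≥0∞ := fun r => expNeg (s * I r) * expNeg (s * J r) * c0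
  have hev : {t : Sample k C | ENNReal.ofReal net.theta < net.sinr t} =
      {p : ℝ × R | ENNReal.ofReal net.theta < ENNReal.ofReal (net.rho * p.1) / X p.2} := rfl
  rw [coverageProb, measureReal_def, hev, sampleLaw, Measure.prod_apply_symm hset]
  congr 1
  have hh : ∀ r : R, expMeasure 1 ((fun h : ℝ => (h, r)) ⁻¹' {p : ℝ × R | ENNReal.ofReal net.theta <
      ENNReal.ofReal (net.rho * p.1) / X p.2}) = F r := by
    intro r
    refine (expMeasure_ratio_gt net.theta_pos net.rho_pos (X r)).trans ?_
    simp only [X, F, c0, mul_add, expNeg_add]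
    rfl
  rw [lintegral_congr hh]
  refine lintegral_mul_mul_const_prod ?_ ?_ (fun ch ψ => ?_) (fun ch => ?_) c0
    (G := fun p : Fin C × (ℕ → Plane) × (ℕ → Plane) × (ℕ → ℝ × ℝ × DeviceState k C) =>
      expNeg (s * net.interCell p.1 (nearestPoint p.2.1) p.2.2.1 p.2.2.2))
    (H := fun p : Fin C × ℕ × (ℕ → ℝ × DeviceState k C) =>
      expNeg (s * net.intraCell p.1 p.2.1 p.2.2))
  · exact measurable_expNeg.comp ((net.measurable_interCell.comp
      (f := fun p : Fin C × (ℕ → Plane) × (ℕ → Plane) × (ℕ → ℝ × ℝ × DeviceState k C) =>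
        (p.1, nearestPoint p.2.1, p.2.2.1, p.2.2.2)) (by fun_prop)).const_mul s)
  · exact measurable_expNeg.comp (net.measurable_intraCell.const_mul s)
  · exact net.lintegral_expNeg_interCell hΦ hΨ π ch (nearestPoint ψ)
  · exact net.lintegral_expNeg_intraCell π ch

end Network

lemma eulerIntegral_nonneg {β z : ℝ} (hz : z ≤ 0) : 0 ≤ eulerIntegral β z := by
  refine intervalIntegral.integral_nonneg zero_le_one fun s hs => inv_nonneg.2 ?_
  have := mul_nonpos_of_nonpos_of_nonneg hz (Real.rpow_nonneg hs.1 β)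
  linarith

lemma gaussHypergeometric_pathLoss {η z : ℝ} (hη : 2 < η) (hz : z < 1) :
    gaussHypergeometric 1 (1 - 2 / η) (2 - 2 / η) z = eulerIntegral (η / (η - 2)) z := by
  have hη0 : 0 < η := by linarith
  have hη2 : 0 < η - 2 := by linarith
  have hb : 1 - 2 / η = (η - 2) / η := by field_simp
  rw [show 2 - 2 / η = 1 - 2 / η + 1 by ring,
    gaussHypergeometric_eq_eulerIntegral (by rw [hb]; positivity) hz, hb, inv_div]

namespace Network

variable (net : Network) {N C : ℕ} {k : Fin N → ℕ}

lemma coverageProb_sharedAccess_eq [NeZero C] {Φ Ψ : Measure (ℕ → Plane)}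
    (hΦ : IsPoissonPointProcess net.mu Φ) (hΨ : IsPoissonPointProcess net.lam Ψ)
    (π : PMF (QueueState k)) (i : Fin N) {δ κ c : ℝ} (hδ : δ = (π 0).toReal)
    (hκ : κ = net.mu / (net.lam * C)) (hc : c = voronoiShape) :
    net.coverageProb Φ Ψ (sharedAccess N C) π i =
      Real.exp (-(net.noise * net.theta / net.rho)
          - 2 * net.theta * (1 - δ) * κ / (net.eta - 2) *
            gaussHypergeometric 1 (1 - 2 / net.eta) (2 - 2 / net.eta) (-net.theta)) /
        (1 + net.theta * (1 - δ) * κ / ((1 + net.theta) * c)) ^ c := by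
  have hθ := net.theta_pos
  have hρ := net.rho_pos
  have hlam := net.lam_pos
  have hmu := net.mu_pos
  have hnoise := net.noise_nonneg
  have hη : 0 < net.eta - 2 := by linarith [net.two_lt_eta]
  have hπ := Real.pi_pos
  have hC : (0 : ℝ) < C := by exact_mod_cast Nat.pos_of_neZero C
  have hc0 : 0 < c := hc ▸ voronoiShape_pos
  have hδ1 : 0 ≤ 1 - δ := by
    have : (π 0).toReal ≤ 1 :=
      ENNReal.toReal_le_of_le_ofReal zero_le_one (by simpa using π.coe_le_one 0)
    linarith
  rw [net.coverageProb_sharedAccess hΦ hΨ π i,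
    gaussHypergeometric_pathLoss net.two_lt_eta (by linarith),
    ← hδ, ← hc]
  set E := eulerIntegral (net.eta / (net.eta - 2)) (-net.theta) with hE
  have hE0 : 0 ≤ E := eulerIntegral_nonneg (by linarith)
  rw [← ENNReal.ofReal_mul (by positivity), ← ENNReal.ofReal_mul (by positivity),
    ← ENNReal.ofReal_mul hmu.le, ← ENNReal.ofReal_mul (by positivity),
    expNeg_ofReal (by positivity),
    expNeg_ofReal (by positivity), ← ENNReal.ofReal_mul (by positivity),
    ← ENNReal.ofReal_mul (by positivity), ENNReal.toReal_ofReal (by positivity)]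
  have hbase : net.lam * c /
      (net.lam * c + net.mu * ((1 - δ) / C * (net.theta / (1 + net.theta)))) =
      (1 + net.theta * (1 - δ) * κ / ((1 + net.theta) * c))⁻¹ := by
    rw [hκ, ← one_div, div_eq_div_iff (by positivity) (by positivity)]
    field_simp
  have hκ0 : 0 ≤ κ := by rw [hκ]; positivity
  rw [hbase, Real.inv_rpow (by positivity), mul_right_comm, ← Real.exp_add, ← div_eq_mul_inv]
  congr 2
  rw [hκ]
  field_simp
  ring

end Network

theorem theorem2 {N C : ℕ} [NeZero C] (k : Fin N → ℕ) (net : Network)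
    (Φ Ψ : Measure (ℕ → Plane)) (hΦ : IsPoissonPointProcess net.mu Φ)
    (hΨ : IsPoissonPointProcess net.lam Ψ) (π : PMF (QueueState k))
    (δ κ c F : ℝ) (hδ : δ = (π 0).toReal) (hκ : κ = net.mu / (net.lam * C)) (hc : c = 3.575)
    (hF : F = Real.exp (-(net.noise * net.theta / net.rho)
          - 2 * net.theta * (1 - δ) * κ / (net.eta - 2) *
            gaussHypergeometric 1 (1 - 2 / net.eta) (2 - 2 / net.eta) (-net.theta)) /
        (1 + net.theta * (1 - δ) * κ / ((1 + net.theta) * c)) ^ c) :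
    -- for every law of the queue lengths, the coverage probability is the same for all classes
    (∀ i j, net.coverageProb Φ Ψ (sharedAccess N C) π i =
      net.coverageProb Φ Ψ (sharedAccess N C) π j) ∧
    -- and it is given by the closed form
    (∀ i, net.coverageProb Φ Ψ (sharedAccess N C) π i = F) ∧
    -- in particular this holds for the network in steady state
    (∀ α p : Fin N → ℝ, net.IsSteadyState Φ Ψ (sharedAccess N C) α p π →
      (∀ i j, p i = p j) ∧ ∀ i, p i = F) ∧
    -- the closed form for path-loss exponent four
    (net.eta = 4 →
      F = Real.exp (-(net.noise * net.theta / net.rho)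
          - (1 - δ) * κ * √net.theta * Real.arctan (√net.theta)) /
        (1 + net.theta * (1 - δ) * κ / ((1 + net.theta) * c)) ^ c) := by

  have hF' : ∀ i, net.coverageProb Φ Ψ (sharedAccess N C) π i = F := fun i => by
    rw [hF]
    exact net.coverageProb_sharedAccess_eq hΦ hΨ π i hδ hκ hc
  refine ⟨fun i j => (hF' i).trans (hF' j).symm, hF', fun α p h => ?_, fun hη => ?_⟩
  · have hp : ∀ i, p i = F := fun i => (h.coverage i).trans (hF' i)
    exact ⟨fun i j => (hp i).trans (hp j).symm, hp⟩
  · have hθ := net.theta_pos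
    have hs : √net.theta ≠ 0 := (Real.sqrt_pos.2 hθ).ne'
    have hsq : net.theta = √net.theta * √net.theta := (Real.mul_self_sqrt hθ.le).symm
    rw [hF, gaussHypergeometric_pathLoss net.two_lt_eta (by linarith), hη,
      show (4 : ℝ) / (4 - 2) = 2 by norm_num, eulerIntegral_two hθ]
    have harc : 2 * net.theta * (1 - δ) * κ / (4 - 2) * (Real.arctan (√net.theta) / √net.theta) =
        (1 - δ) * κ * √net.theta * Real.arctan (√net.theta) := by
      rw [← mul_div_assoc, div_eq_iff hs]
      linear_combination (1 - δ) * κ * Real.arctan (√net.theta) * hsq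
    rw [harc]
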